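/- For a group $G$ let $\gamma_1(G)=G$, $\gamma_{\alpha+1}(G)=[\gamma_\alpha(G),G]$ for every ordinal $\alpha\ge 1$, and $\gamma_\alpha(G)=\bigcap_{1\le\beta<\alpha}\gamma_\beta(G)$ for every limit ordinal $\alpha$ (the transfinite lower central series). The length of the lower central series of $G$ is the smallest ordinal $\alpha\ge 1$ with $\gamma_\alpha(G)=\gamma_{\alpha+1}(G)$. The group $G$ is residually nilpotent if for every $x\in G$, $x\ne1$, there is a normal subgroup $N$ of $G$ with $x\notin N$ and $G/N$ nilpotent. Let $F_n$ be the free group of finite rank $n$, let $\varphi\in\mathrm{Aut}(F_n)$, and let $G=F_n\rtimes_\varphi\mathbb{Z}$, where a generator of $\mathbb{Z}$ acts on $F_n$ by $\varphi$. Let $\overline\varphi$ be the automorphism of the free abelian group $F_n^{ab}=F_n/[F_n,F_n]$ induced by $\varphi$, and for $k\ge1$ let $\overline\varphi_k=\overline\varphi^{\otimes k}$ be the automorphism $x_1\otimes\dots\otimes x_k\mapsto\overline\varphi(x_1)\otimes\dots\otimes\overline\varphi(x_k)$ of the $k$-th tensor power $(F_n^{ab})^{\otimes k}$ over $\mathbb{Z}$.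 Suppose that for every $k\ge1$ the group $(F_n^{ab})^{\otimes k}\rtimes_{\overline\varphi_k}\mathbb{Z}$ is residually nilpotent. Then $\gamma_{\omega^2}(G)=1$. If, in addition, $G$ is not residually nilpotent, then the length of the lower central series of $G$ is equal to $\omega^2$. -/

import Mathlib

open scoped TensorProduct Ordinal

noncomputable section

universe u

/-- A group `G` is residually nilpotent if every non-identity element lies outside some
normal subgroup with nilpotent quotient. -/
def ResiduallyNilpotent (G : Type u) [Group G] : Prop :=
  ∀ x : G, x ≠ 1 → ∃ (N : Subgroup G) (_ : N.Normal), x ∉ N ∧ Group.IsNilpotent (G ⧸ N)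

/-- The transfinite lower central series `γ_α(G)`, indexed so that `γ_1(G) = G`,
`γ_{α+1}(G) = [γ_α(G), G]` for `α ≥ 1`, and `γ_α(G)` is the intersection of the earlier terms
when `α` is a limit. The value at `0`, which is not part of the series, is set to `G`. -/
def transLCS (G : Type u) [Group G] (α : Ordinal.{u}) : Subgroup G :=
  Ordinal.limitRecOn (motive := fun _ => Subgroup G) α ⊤
    (fun β H => if β = 0 then ⊤ else ⁅H, (⊤ : Subgroup G)⁆)
    (fun β _ ih => ⨅ (δ : Ordinal.{u}) (hδ : δ < β), ih δ hδ)

theorem transLCS_zero (G : Type u) [Group G] : transLCS G 0 = ⊤ := by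
  simp [transLCS]

theorem transLCS_one (G : Type u) [Group G] : transLCS G 1 = ⊤ := by
  have h := Ordinal.limitRecOn_add_one (motive := fun _ => Subgroup G) 0 ⊤
    (fun β H => if β = 0 then ⊤ else ⁅H, (⊤ : Subgroup G)⁆)
    (fun β _ ih => ⨅ (δ : Ordinal.{u}) (hδ : δ < β), ih δ hδ)
  rw [zero_add] at h
  simpa [transLCS] using h

theorem transLCS_add_one (G : Type u) [Group G] {α : Ordinal.{u}} (hα : 1 ≤ α) :
    transLCS G (α + 1) = ⁅transLCS G α, (⊤ : Subgroup G)⁆ := by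
  have h0 : α ≠ 0 := Order.one_le_iff_ne_zero.mp hα
  unfold transLCS
  rw [Ordinal.limitRecOn_add_one, if_neg h0]

theorem transLCS_limit (G : Type u) [Group G] {α : Ordinal.{u}} (hα : Order.IsSuccLimit α) :
    transLCS G α = ⨅ (β : Ordinal.{u}) (_ : β < α), transLCS G β := by
  unfold transLCS
  rw [Ordinal.limitRecOn_limit _ _ _ _ hα]

/-- `α` is the length of the lower central series of `G`: the smallest (positive) ordinal with
`γ_α(G) = γ_{α+1}(G)`. -/
def IsLCSLength (G : Type u) [Group G] (α : Ordinal.{u}) : Prop :=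
  IsLeast {β : Ordinal.{u} | 1 ≤ β ∧ transLCS G β = transLCS G (β + 1)} α

/-- The semidirect product `A ⋊_ψ ℤ`, a generator of the infinite cyclic group acting
on `A` by the automorphism `ψ`. -/
abbrev CyclicExt (A : Type u) [Group A] (ψ : MulAut A) : Type u :=
  A ⋊[zpowersHom (MulAut A) ψ] (Multiplicative ℤ)

/-- The abelianization of the free group of rank `n`, written additively. -/
abbrev FreeAb (n : ℕ) : Type := Additive (Abelianization (FreeGroup (Fin n)))

/-- The `ℤ`-linear automorphism of `F_n^{ab}` induced by an automorphism of `F_n`. -/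
def abAut {n : ℕ} (φ : MulAut (FreeGroup (Fin n))) : FreeAb n ≃ₗ[ℤ] FreeAb n :=
  (MulEquiv.toAdditive (MulEquiv.abelianizationCongr φ)).toIntLinearEquiv

/-- The `k`-th tensor power of `F_n^{ab}` over `ℤ`, written multiplicatively. -/
abbrev FreeAbTensor (n k : ℕ) : Type := Multiplicative (⨂[ℤ]^k (FreeAb n))

/-- The automorphism `x₁ ⊗ ⋯ ⊗ x_k ↦ φ̄(x₁) ⊗ ⋯ ⊗ φ̄(x_k)` of `(F_n^{ab})^{⊗ k}`. -/
def tensorAut {n : ℕ} (φ : MulAut (FreeGroup (Fin n))) (k : ℕ) : MulAut (FreeAbTensor n k) :=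
  AddEquiv.toMultiplicative
    (PiTensorProduct.congr (R := ℤ) (fun _ : Fin k => abAut φ)).toAddEquiv

end

/-! Write F for F_n and, for k ≥ 1, let D_k be the subgroup of those f with f − 1 in the k-th power
of the augmentation ideal I of ℤF; equivalently, the Magnus series of f is 1 up to degree k − 1. The
degree-k coefficient embeds D_k/D_{k+1} in the tensor power T_k of F^ab. Conjugation by F fixes such
leading terms and the generator of ℤ acts on them as φ̄_k, so a commutator with any element of G
applies Ω = φ̄_k − 1, up to an operator commuting with Ω. If γ_α ≤ D_k, the leading terms of γ_{α+m}
therefore lie in Ω^m T_k. Residual nilpotence of T_k ⋊ ℤ forces ⋂ Ω^m T_k = 0, whence γ_{α+ω} ≤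
D_{k+1} (`exists_magnusTrivialBelow_succ`). So γ_{ω(k+1)} ≤ D_{k+2}, and ⋂ D_k = 1
(`FreeGroup.eq_one_of_forall_mem_augPow`) gives γ_{ω²} = 1.

If the series stabilised before ω², then γ_{ω(k+1)} = 1 for some k. Since [γ_{ω(k+1)}, γ_ω] ≤
γ_{ω(k+2)} for every k, γ_ω would be solvable. It is normal and lies in D_2 ≤ [F, F], and a solvable
normal subgroup of a free group inside the derived subgroup is trivial. Then γ_ω = 1 and G is
residually nilpotent. -/

/-! ### The transfinite lower central series of an arbitrary group -/

section TransfiniteLCS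

variable {G : Type u} [Group G]

instance transLCS_normal (α : Ordinal.{u}) : (transLCS G α).Normal := by
  induction α using Ordinal.limitRecOn with
  | zero => rw [transLCS_zero]; infer_instance
  | add_one β ih =>
    by_cases hβ : β = 0
    · subst hβ
      rw [zero_add, transLCS_one]; infer_instance
    · rw [transLCS_add_one G (Order.one_le_iff_ne_zero.mpr hβ)]
      infer_instance
  | limit β hβ ih =>
    rw [transLCS_limit G hβ]
    exact Subgroup.normal_iInf_normal fun δ => Subgroup.normal_iInf_normal fun hδ => ih δ hδ

theorem transLCS_add_one_le (α : Ordinal.{u}) : transLCS G (α + 1) ≤ transLCS G α := by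
  by_cases h : α = 0
  · subst h
    rw [transLCS_zero]
    exact le_top
  · rw [transLCS_add_one G (Order.one_le_iff_ne_zero.mpr h)]
    exact Subgroup.commutator_le_left _ _

theorem transLCS_antitone : Antitone (transLCS G) := by
  intro α β
  induction β using Ordinal.limitRecOn with
  | zero =>
    intro h
    rw [nonpos_iff_eq_zero.mp h]
  | add_one β ih =>
    intro h
    rcases h.lt_or_eq with h | h
    · exact (transLCS_add_one_le β).trans (ih (Order.lt_add_one_iff.mp h))
    · rw [h]
  | limit β hβ ih =>
    intro h
    rcases h.lt_or_eq with h | h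
    · rw [transLCS_limit G hβ]
      exact iInf₂_le α h
    · rw [h]

theorem transLCS_eq_of_eq_add_one {α : Ordinal.{u}} (h1 : 1 ≤ α)
    (h : transLCS G α = transLCS G (α + 1)) {β : Ordinal.{u}} (hβ : α ≤ β) :
    transLCS G β = transLCS G α := by
  induction β using Ordinal.limitRecOn with
  | zero =>
    rw [nonpos_iff_eq_zero.mp hβ]
  | add_one β ih =>
    rcases hβ.lt_or_eq with hlt | heq
    · have hle := Order.lt_add_one_iff.mp hlt
      rw [transLCS_add_one G (h1.trans hle), ih hle, ← transLCS_add_one G h1, ← h]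
    · rw [heq]
  | limit β hlim ih =>
    refine le_antisymm (transLCS_antitone hβ) ?_
    rw [transLCS_limit G hlim]
    refine le_iInf₂ fun δ hδ => ?_
    rcases le_total α δ with hle | hle
    · exact (ih δ hδ hle).ge
    · exact transLCS_antitone hle

theorem transLCS_natCast_add_one (m : ℕ) :
    transLCS G ((m : Ordinal.{u}) + 1) = (⊤ : Subgroup G).lowerCentralSeries m := by
  induction m with
  | zero => rw [Nat.cast_zero, zero_add, transLCS_one]; rfl
  | succ m ih =>
    rw [transLCS_add_one G (by simp), Nat.cast_succ, ih]
    rfl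

theorem residuallyNilpotent_of_transLCS_omega0 (h : transLCS G ω = ⊥) : ResiduallyNilpotent G := by
  intro x hx
  have hx' : x ∉ transLCS G ω := by rwa [h, Subgroup.mem_bot]
  rw [transLCS_limit G Ordinal.isSuccLimit_omega0] at hx'
  simp only [Subgroup.mem_iInf, not_forall] at hx'
  obtain ⟨β, hβ, hxβ⟩ := hx'
  obtain ⟨m, rfl⟩ := Ordinal.lt_omega0.mp hβ
  -- Passing to m + 1 matches the index shift against `lowerCentralSeries`, and covers m = 0.
  have hm : x ∉ transLCS G ((m : Ordinal.{u}) + 1) := fun hmem =>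
    hxβ (transLCS_add_one_le _ hmem)
  refine ⟨_, inferInstance, hm, ?_⟩
  rw [Subgroup.nilpotent_iff_lowerCentralSeries]
  refine ⟨m, ?_⟩
  rw [← Subgroup.map_top_of_surjective _ (QuotientGroup.mk'_surjective (transLCS G ((m : Ordinal.{u}) + 1))),
    ← Subgroup.map_lowerCentralSeries, ← transLCS_natCast_add_one, QuotientGroup.map_mk'_self]

theorem ResiduallyNilpotent.iInf_lowerCentralSeries (h : ResiduallyNilpotent G) {x : G}
    (hx : ∀ m : ℕ, x ∈ (⊤ : Subgroup G).lowerCentralSeries m) : x = 1 := by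
  by_contra hne
  obtain ⟨N, hN, hxN, hnil⟩ := h x hne
  obtain ⟨m, hm⟩ := Subgroup.nilpotent_iff_lowerCentralSeries.mp hnil
  refine hxN ((QuotientGroup.eq_one_iff x).mp ?_)
  rw [← Subgroup.mem_bot, ← hm, ← Subgroup.map_top_of_surjective _ (QuotientGroup.mk'_surjective N),
    ← Subgroup.map_lowerCentralSeries]
  exact ⟨x, hx m, rfl⟩

/-- The three subgroups lemma. -/
theorem commutator_commutator_le_of_rotate {H₁ H₂ H₃ N : Subgroup G} [N.Normal]
    (h1 : ⁅⁅H₂, H₃⁆, H₁⁆ ≤ N) (h2 : ⁅⁅H₃, H₁⁆, H₂⁆ ≤ N) : ⁅⁅H₁, H₂⁆, H₃⁆ ≤ N := by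
  have key : ∀ A B C : Subgroup G, ⁅⁅A, B⁆, C⁆ ≤ N ↔
      ⁅⁅A.map (QuotientGroup.mk' N), B.map (QuotientGroup.mk' N)⁆, C.map (QuotientGroup.mk' N)⁆
        = ⊥ := by
    intro A B C
    rw [← Subgroup.map_commutator, ← Subgroup.map_commutator, Subgroup.map_eq_bot_iff,
      QuotientGroup.ker_mk']
  rw [key] at *
  exact Subgroup.commutator_commutator_eq_bot_of_rotate h1 h2

/-- Induction on m by the three subgroups lemma; α must vary, because one rotation uses the case m
at α + 1. -/
theorem commutator_transLCS_natCast_le {α : Ordinal.{u}} (hα : 1 ≤ α) (m : ℕ) :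
    ⁅transLCS G α, transLCS G (m : Ordinal.{u})⁆ ≤ transLCS G (α + m) := by
  induction m generalizing α with
  | zero =>
    rw [Nat.cast_zero, add_zero]
    exact Subgroup.commutator_le_left _ _
  | succ m ih =>
    -- The recursion for successors starts at index 1, so γ_1 = G has to be treated apart.
    rcases Nat.eq_zero_or_pos m with rfl | hm
    · rw [zero_add, Nat.cast_one, transLCS_one, transLCS_add_one G hα]
    · have hm1 : (1 : Ordinal.{u}) ≤ m := by exact_mod_cast hm
      rw [Nat.cast_succ, transLCS_add_one G hm1, Subgroup.commutator_comm]
      have hαm : 1 ≤ α + m := hα.trans le_self_add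
      have e : α + (m + 1 : Ordinal.{u}) = α + m + 1 := (add_assoc _ _ _).symm
      have e' : α + 1 + m = α + m + 1 := by
        rw [add_assoc]
        have : (1 + m : Ordinal.{u}) = m + 1 := by exact_mod_cast add_comm 1 m
        rw [this, e]
      refine commutator_commutator_le_of_rotate ?_ ?_
      · rw [Subgroup.commutator_comm ⊤, ← transLCS_add_one G hα, e, ← e']
        exact ih (hα.trans le_self_add)
      · rw [e, transLCS_add_one G hαm]
        exact Subgroup.commutator_mono (ih hα) le_rfl

theorem lt_omega0_mul_add_one {δ : Ordinal.{u}} {k : ℕ} (h : δ < ω * ((k : Ordinal.{u}) + 1)) :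
    ∃ m : ℕ, δ ≤ ω * k + m := by
  obtain ⟨q, hq, r, hr, rfl⟩ := Ordinal.lt_mul_iff.mp h
  obtain ⟨m, rfl⟩ := Ordinal.lt_omega0.mp hr
  exact ⟨m, add_le_add (mul_le_mul_right (Order.lt_add_one_iff.mp hq) _) le_rfl⟩

theorem lt_omega0_sq {δ : Ordinal.{u}} (h : δ < ω ^ 2) : ∃ k : ℕ, δ ≤ ω * ((k : Ordinal.{u}) + 1) := by
  rw [sq] at h
  obtain ⟨q, hq, r, hr, rfl⟩ := Ordinal.lt_mul_iff.mp h
  obtain ⟨k, rfl⟩ := Ordinal.lt_omega0.mp hq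
  exact ⟨k, by rw [mul_add_one]; exact add_le_add le_rfl hr.le⟩

theorem isSuccLimit_omega0_mul_add_one (k : ℕ) :
    Order.IsSuccLimit (ω * ((k : Ordinal.{u}) + 1)) := by
  rw [mul_add_one]
  exact Ordinal.isSuccLimit_add _ Ordinal.isSuccLimit_omega0

theorem mem_transLCS_omega0_mul_add_one {k : ℕ} {x : G}
    (hx : ∀ m : ℕ, x ∈ transLCS G (ω * k + m)) : x ∈ transLCS G (ω * ((k : Ordinal.{u}) + 1)) := by
  rw [transLCS_limit G (isSuccLimit_omega0_mul_add_one k)]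
  simp only [Subgroup.mem_iInf]
  intro δ hδ
  obtain ⟨m, hm⟩ := lt_omega0_mul_add_one hδ
  exact transLCS_antitone hm (hx m)

/-- As γ_ω ≤ γ_m for every finite m, the commutator lies in all γ_{ω(k+1)+m}, hence in the next
limit term. -/
theorem commutator_transLCS_omega0_le (k : ℕ) :
    ⁅transLCS G (ω * ((k : Ordinal.{u}) + 1)), transLCS G ω⁆ ≤
      transLCS G (ω * (((k + 1 : ℕ) : Ordinal.{u}) + 1)) := by
  intro x hx
  refine mem_transLCS_omega0_mul_add_one fun m => ?_
  rw [Nat.cast_succ]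
  refine commutator_transLCS_natCast_le ?_ m (Subgroup.commutator_mono le_rfl
    (transLCS_antitone (Ordinal.natCast_lt_omega0 m).le) hx)
  rw [mul_add_one]
  exact Ordinal.one_lt_omega0.le.trans le_add_self

theorem derivedSeries_transLCS_omega0_le (k : ℕ) :
    (derivedSeries (transLCS G ω) k).map (transLCS G ω).subtype ≤
      transLCS G (ω * ((k : Ordinal.{u}) + 1)) := by
  induction k with
  | zero =>
    rw [Nat.cast_zero, zero_add, mul_one]
    exact Subgroup.map_subtype_le _
  | succ k ih =>
    rw [derivedSeries_succ, Subgroup.map_commutator]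
    exact (Subgroup.commutator_mono ih (Subgroup.map_subtype_le _)).trans
      (commutator_transLCS_omega0_le k)

/-- If the series reaches the trivial group before `ω ^ 2`, then `γ_ω` is solvable. -/
theorem isSolvable_transLCS_omega0 {α : Ordinal.{u}} (hα : α < ω ^ 2) (h : transLCS G α = ⊥) :
    Group.IsSolvable (transLCS G ω) := by
  obtain ⟨k, hk⟩ := lt_omega0_sq hα
  refine ⟨⟨k, ?_⟩⟩
  rw [← Subgroup.map_eq_bot_iff_of_injective _ (transLCS G ω).subtype_injective, eq_bot_iff, ← h]
  exact (derivedSeries_transLCS_omega0_le k).trans (transLCS_antitone hk)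

end TransfiniteLCS

/-! ### Solvable subgroups of free groups -/

section FreeSolvable

/-- Two distinct letters can be sent to a 5-cycle and an adjacent transposition, which generate the
non-solvable group S_5. -/
theorem FreeGroup.subsingleton_of_isSolvable {X : Type*} (h : Group.IsSolvable (FreeGroup X)) :
    Subsingleton X := by
  classical
  refine ⟨fun a b => ?_⟩
  by_contra hab
  let σ : Equiv.Perm (Fin 5) := finRotate 5
  let f : FreeGroup X →* Equiv.Perm (Fin 5) :=
    FreeGroup.lift fun x => if x = a then σ else if x = b then Equiv.swap 0 (σ 0) else 1
  have hf : Function.Surjective f := by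
    rw [← MonoidHom.range_eq_top, eq_top_iff,
      ← Equiv.Perm.closure_cycle_adjacent_swap (σ := σ) isCycle_finRotate support_finRotate 0,
      Subgroup.closure_le]
    rintro x (rfl | rfl)
    · exact ⟨FreeGroup.of a, by simp [f]⟩
    · exact ⟨FreeGroup.of b, by simp [f, Ne.symm hab]⟩
  exact Equiv.Perm.not_isSolvable_fin_5 (Group.isSolvable_of_surjective hf)

theorem FreeGroup.exists_zpowers_eq_top {X : Type*} [Subsingleton X] :
    ∃ c : FreeGroup X, Subgroup.zpowers c = ⊤ := by
  rcases isEmpty_or_nonempty X with hX | ⟨⟨x⟩⟩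
  · exact ⟨1, eq_top_iff.mpr fun y _ => by rw [Subsingleton.elim y 1]; exact one_mem _⟩
  · refine ⟨FreeGroup.of x, eq_top_iff.mpr ?_⟩
    rw [← FreeGroup.closure_range_of, Subgroup.closure_le]
    rintro _ ⟨y, rfl⟩
    rw [Subsingleton.elim y x]
    exact Subgroup.mem_zpowers _

/-- Solvable subgroups of free groups are cyclic. -/
theorem FreeGroup.exists_le_zpowers_of_isSolvable {X : Type u} (S : Subgroup (FreeGroup X))
    (hS : Group.IsSolvable S) : ∃ c : FreeGroup X, S ≤ Subgroup.zpowers c := by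
  -- Nielsen–Schreier: S is itself free, so solvability leaves it at most one generator.
  let e := IsFreeGroup.toFreeGroup S
  have := FreeGroup.subsingleton_of_isSolvable (Group.isSolvable_of_surjective (f := e.toMonoidHom) e.surjective)
  obtain ⟨c, hc⟩ := FreeGroup.exists_zpowers_eq_top (X := IsFreeGroup.Generators S)
  refine ⟨(e.symm c : S), fun y hy => ?_⟩
  obtain ⟨j, hj⟩ := Subgroup.mem_zpowers_iff.mp (hc ▸ Subgroup.mem_top (e ⟨y, hy⟩))
  refine Subgroup.mem_zpowers_iff.mpr ⟨j, ?_⟩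
  rw [← Subgroup.coe_zpow, ← map_zpow, hj, MulEquiv.symm_apply_apply]

theorem isSolvable_sup_zpowers {F : Type*} [Group F] (H : Subgroup F) [H.Normal]
    (hH : Group.IsSolvable H) (g : F) : Group.IsSolvable (H ⊔ Subgroup.zpowers g : Subgroup F) := by
  set S := H ⊔ Subgroup.zpowers g with hS
  let q : S →* Subgroup.zpowers (QuotientGroup.mk' H g) :=
    ((QuotientGroup.mk' H).comp S.subtype).codRestrict _ (by
      have hle : S ≤ (Subgroup.zpowers (QuotientGroup.mk' H g)).comap (QuotientGroup.mk' H) := by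
        refine sup_le (fun x hx => ?_) ?_
        · rw [Subgroup.mem_comap, show QuotientGroup.mk' H x = 1 from (QuotientGroup.eq_one_iff x).mpr hx]
          exact one_mem _
        · rw [Subgroup.zpowers_le]
          exact Subgroup.mem_zpowers _
      exact fun x => hle x.2)
  have hcyc : Group.IsSolvable (Subgroup.zpowers (QuotientGroup.mk' H g)) :=
    Group.isSolvable_of_comm fun a b => mul_comm' a b
  refine Group.isSolvable_of_ker_le_range (Subgroup.inclusion (le_sup_left : H ≤ S)) q fun x hx => ?_
  have hx' : (QuotientGroup.mk' H) x.1 = 1 := congrArg Subtype.val (MonoidHom.mem_ker.mp hx)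
  exact ⟨⟨x.1, (QuotientGroup.eq_one_iff _).mp hx'⟩, rfl⟩

/-- A solvable normal subgroup of a free group which is contained in the derived subgroup is
trivial. -/
theorem FreeGroup.eq_bot_of_isSolvable_of_le_commutator {X : Type u} (H : Subgroup (FreeGroup X))
    [H.Normal] (hH : Group.IsSolvable H) (hle : H ≤ commutator (FreeGroup X)) : H = ⊥ := by
  classical
  refine (Subgroup.eq_bot_iff_forall _).mpr fun h hh => ?_
  rcases isEmpty_or_nonempty X with hX | ⟨⟨x⟩⟩
  · exact Subsingleton.elim _ _
  -- H together with a generator x is still solvable, hence inside some ⟨c⟩: h = c^j and x = c^i.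
  -- The exponent sum f has f(x) = 1, so f(c) ≠ 0, while f(h) = 0; hence j = 0.
  obtain ⟨c, hc⟩ := FreeGroup.exists_le_zpowers_of_isSolvable _
    (isSolvable_sup_zpowers H hH (FreeGroup.of x))
  obtain ⟨j, hj⟩ := Subgroup.mem_zpowers_iff.mp (hc (Subgroup.mem_sup_left hh))
  obtain ⟨i, hi⟩ := Subgroup.mem_zpowers_iff.mp
    (hc (Subgroup.mem_sup_right (Subgroup.mem_zpowers (FreeGroup.of x))))
  let f : FreeGroup X →* Multiplicative ℤ := FreeGroup.lift fun _ => Multiplicative.ofAdd 1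
  have hfh : f h = 1 := Abelianization.commutator_subset_ker f (hle hh)
  have hfx : f (FreeGroup.of x) = Multiplicative.ofAdd 1 := by simp [f]
  rw [← hi, map_zpow] at hfx
  rw [← hj, map_zpow] at hfh
  have h1 : i * Multiplicative.toAdd (f c) = 1 := by
    have := congrArg Multiplicative.toAdd hfx
    simpa using this
  have h2 : j * Multiplicative.toAdd (f c) = 0 := by
    have := congrArg Multiplicative.toAdd hfh
    simpa using this
  have hj0 : j = 0 := by
    rcases mul_eq_zero.mp h2 with h | h
    · exact h
    · rw [h, mul_zero] at h1; exact absurd h1 (by norm_num)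
  rw [← hj, hj0, zpow_zero]

end FreeSolvable

/-! ### Lowest-degree coefficients of products of power series -/

section PowerSeriesCoeff

open PowerSeries

theorem PowerSeries.coeff_mul_eq_zero {A : Type*} [Ring A] {f g : A⟦X⟧} {a b : ℕ}
    (hf : ∀ j < a, coeff j f = 0) (hg : ∀ j < b, coeff j g = 0) {m : ℕ} (hm : m < a + b) :
    coeff m (f * g) = 0 := by
  rw [coeff_mul]
  refine Finset.sum_eq_zero fun p hp => ?_
  rw [Finset.HasAntidiagonal.mem_antidiagonal] at hp
  rcases lt_or_ge p.1 a with h | h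
  · rw [hf _ h, zero_mul]
  · rw [hg _ (by omega), mul_zero]

theorem PowerSeries.coeff_add_mul {A : Type*} [Ring A] {f g : A⟦X⟧} {a b : ℕ}
    (hf : ∀ j < a, coeff j f = 0) (hg : ∀ j < b, coeff j g = 0) :
    coeff (a + b) (f * g) = coeff a f * coeff b g := by
  rw [coeff_mul]
  refine Finset.sum_eq_single (a, b) (fun p hp hne => ?_) (fun h => ?_)
  · rw [Finset.HasAntidiagonal.mem_antidiagonal] at hp
    rcases lt_or_ge p.1 a with h | h
    · rw [hf _ h, zero_mul]
    · rcases h.lt_or_eq with h | h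
      · rw [hg _ (by omega), mul_zero]
      · exact absurd (Prod.ext h.symm (by simp only; omega)) hne
  · exact absurd (Finset.HasAntidiagonal.mem_antidiagonal.mpr (show (a, b).1 + (a, b).2 = a + b from rfl)) h

/-- The unit `1 + a X` of a ring of power series. -/
noncomputable def PowerSeries.oneAddMulX {A : Type*} [Ring A] (a : A) : A⟦X⟧ˣ where
  val := 1 + C a * X
  inv := PowerSeries.mk fun j => (-a) ^ j
  val_inv := by
    ext m
    rw [add_mul, one_mul, map_add, mul_assoc, coeff_C_mul, coeff_mk]
    cases m with
    | zero => simp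
    | succ m => simp [coeff_succ_X_mul, pow_succ', coeff_one]
  inv_val := by
    ext m
    rw [mul_add, mul_one, map_add, ← mul_assoc, coeff_mk]
    cases m with
    | zero => simp
    | succ m => simp [coeff_succ_mul_X, coeff_mul_C, pow_succ, coeff_one]

end PowerSeriesCoeff

/-! ### Powers of the augmentation ideal of the integral group ring -/

section AugmentationPowers

variable {F : Type*} [Group F]

/-- The augmentation of the integral group ring. -/
noncomputable def groupRingAug (F : Type*) [Group F] : MonoidAlgebra ℤ F →ₐ[ℤ] ℤ :=
  MonoidAlgebra.lift ℤ ℤ F 1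

theorem groupRingAug_of (f : F) : groupRingAug F (MonoidAlgebra.of ℤ F f) = 1 := by
  simp [groupRingAug]

/-- The augmentation ideal of the integral group ring. -/
noncomputable def augSubmodule (F : Type*) [Group F] : Submodule ℤ (MonoidAlgebra ℤ F) :=
  LinearMap.ker (groupRingAug F).toLinearMap

theorem mem_augSubmodule {u : MonoidAlgebra ℤ F} : u ∈ augSubmodule F ↔ groupRingAug F u = 0 :=
  Iff.rfl

theorem of_sub_one_mem_augSubmodule (f : F) : MonoidAlgebra.of ℤ F f - 1 ∈ augSubmodule F := by
  rw [mem_augSubmodule, map_sub, groupRingAug_of, map_one, sub_self]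

/-- The powers of the augmentation ideal of the integral group ring. -/
noncomputable def augPow (F : Type*) [Group F] : ℕ → Submodule ℤ (MonoidAlgebra ℤ F)
  | 0 => ⊤
  | k + 1 => augPow F k * augSubmodule F

theorem groupRing_induction {p : MonoidAlgebra ℤ F → Prop} (u : MonoidAlgebra ℤ F)
    (of : ∀ f, p (MonoidAlgebra.of ℤ F f)) (add : ∀ u v, p u → p v → p (u + v))
    (smul : ∀ (r : ℤ) u, p u → p (r • u)) : p u :=
  MonoidAlgebra.induction_on u of add smul

theorem augSubmodule_le_span :
    augSubmodule F ≤ Submodule.span ℤ (Set.range fun f : F => MonoidAlgebra.of ℤ F f - 1) := by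
  have key : ∀ u : MonoidAlgebra ℤ F, u - groupRingAug F u • 1 ∈
      Submodule.span ℤ (Set.range fun f : F => MonoidAlgebra.of ℤ F f - 1) := by
    intro u
    induction u using groupRing_induction with
    | of f => rw [groupRingAug_of, one_smul]; exact Submodule.subset_span ⟨f, rfl⟩
    | add u v hu hv =>
      have := Submodule.add_mem _ hu hv
      rw [map_add, add_smul]
      convert this using 1
      abel
    | smul r u hu =>
      have := Submodule.smul_mem _ r hu
      rwa [map_smul, smul_assoc, ← smul_sub]
  intro u hu
  have := key u
  rwa [mem_augSubmodule.mp hu, zero_smul, sub_zero] at this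

/-- The endomorphism of the group ring induced by a group endomorphism. -/
noncomputable def groupRingMap (φ : F →* F) : MonoidAlgebra ℤ F →ₐ[ℤ] MonoidAlgebra ℤ F :=
  MonoidAlgebra.mapDomainAlgHom ℤ ℤ φ

theorem groupRingMap_of (φ : F →* F) (f : F) :
    groupRingMap φ (MonoidAlgebra.of ℤ F f) = MonoidAlgebra.of ℤ F (φ f) := by
  simp [groupRingMap]

theorem groupRingAug_groupRingMap (φ : F →* F) (u : MonoidAlgebra ℤ F) :
    groupRingAug F (groupRingMap φ u) = groupRingAug F u := by
  induction u using groupRing_induction with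
  | of f => rw [groupRingMap_of, groupRingAug_of, groupRingAug_of]
  | add u v hu hv => simp only [map_add, hu, hv]
  | smul r u hu => simp only [map_smul, hu]

theorem groupRingMap_mem_augSubmodule (φ : F →* F) {u : MonoidAlgebra ℤ F}
    (hu : u ∈ augSubmodule F) : groupRingMap φ u ∈ augSubmodule F := by
  rw [mem_augSubmodule] at *
  rw [groupRingAug_groupRingMap, hu]

theorem groupRingMap_mem_augPow (φ : F →* F) (k : ℕ) {u : MonoidAlgebra ℤ F}
    (hu : u ∈ augPow F k) : groupRingMap φ u ∈ augPow F k := by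
  induction k generalizing u with
  | zero => trivial
  | succ k ih =>
    induction hu using Submodule.mul_induction_on' with
    | mem_mul_mem a ha b hb =>
      rw [map_mul]
      exact Submodule.mul_mem_mul (ih ha) (groupRingMap_mem_augSubmodule φ hb)
    | add a ha b hb h1 h2 =>
      rw [map_add]
      exact add_mem h1 h2

end AugmentationPowers

/-! ### The augmentation powers of a free group ring meet the group trivially -/

section Faithful

variable {n : ℕ}

/-- The operator on integer sequences that shifts by one at the places `j` where the `j`-th letter
of `L` is `i`. -/
def letterShift (L : List (Fin n)) (i : Fin n) : Module.End ℤ (ℕ → ℤ) where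
  toFun v j := if L[j]? = some i then v (j + 1) else 0
  map_add' v w := by
    ext j
    by_cases h : L[j]? = some i <;> simp [h]
  map_smul' r v := by
    ext j
    by_cases h : L[j]? = some i <;> simp [h]

theorem letterShift_apply (L : List (Fin n)) (i : Fin n) (v : ℕ → ℤ) (j : ℕ) :
    letterShift L i v j = if L[j]? = some i then v (j + 1) else 0 := rfl

/-- Applying the shift twice needs the letter i at two adjacent places of L. -/
theorem letterShift_mul_self {L : List (Fin n)} (hL : L.IsChain (· ≠ ·)) (i : Fin n) :
    letterShift L i * letterShift L i = 0 := by
  ext v j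
  rw [Module.End.mul_apply, letterShift_apply, letterShift_apply]
  split_ifs with h1 h2
  · obtain ⟨hj, h1⟩ := List.getElem?_eq_some_iff.mp h1
    obtain ⟨hj', h2⟩ := List.getElem?_eq_some_iff.mp h2
    exact absurd (h1.trans h2.symm) (List.isChain_iff_getElem.mp hL j hj')
  · rfl
  · rfl

/-- The unit `1 + a` attached to an element `a` of square zero. -/
def oneAddUnit {A : Type*} [Ring A] (a : A) (ha : a * a = 0) : Aˣ where
  val := 1 + a
  inv := 1 - a
  val_inv := by rw [add_mul, mul_sub, mul_sub, ha]; simp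
  inv_val := by rw [sub_mul, mul_add, mul_add, ha]; simp

theorem oneAddUnit_zpow {A : Type*} [Ring A] (a : A) (ha : a * a = 0) (e : ℤ) :
    ((oneAddUnit a ha ^ e : Aˣ) : A) = 1 + e • a := by
  induction e with
  | zero => simp
  | succ e ih =>
    rw [zpow_add_one, Units.val_mul, ih]
    change (1 + (e : ℤ) • a) * (1 + a) = _
    rw [add_mul, mul_add, mul_add, smul_mul_assoc, smul_mul_assoc, ha, add_smul]
    simp
    abel
  | pred e ih =>
    rw [zpow_sub_one, Units.val_mul, ih]
    change (1 + (-(e : ℤ)) • a) * (1 - a) = _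
    rw [add_mul, mul_sub, mul_sub, smul_mul_assoc, smul_mul_assoc, ha, sub_smul]
    simp
    abel

/-- The unipotent representation of a free group on integer sequences attached to a list of
letters without repetitions of neighbours. -/
def letterRep (L : List (Fin n)) (hL : L.IsChain (· ≠ ·)) :
    FreeGroup (Fin n) →* (Module.End ℤ (ℕ → ℤ))ˣ :=
  FreeGroup.lift fun i => oneAddUnit (letterShift L i) (letterShift_mul_self hL i)

theorem letterRep_of (L : List (Fin n)) (hL : L.IsChain (· ≠ ·)) (i : Fin n) :
    letterRep L hL (FreeGroup.of i) = oneAddUnit (letterShift L i) (letterShift_mul_self hL i) :=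
  FreeGroup.lift_apply_of

/-- A sequence is supported below `m`. -/
def SupportedBelow (m : ℕ) (v : ℕ → ℤ) : Prop := ∀ i, m ≤ i → v i = 0

/-- Each power of a generator is 1 plus a multiple of a shift, so f − 1 lowers the bound of the
support by one. This makes the k-th power of I lower it by k. -/
theorem letterRep_sub_one {L : List (Fin n)} (hL : L.IsChain (· ≠ ·)) (f : FreeGroup (Fin n))
    {m : ℕ} {v : ℕ → ℤ} (hv : SupportedBelow (m + 1) v) :
    SupportedBelow m ((letterRep L hL f : Module.End ℤ (ℕ → ℤ)) v - v) := by
  have key : ∀ (i : Fin n) (e : ℤ) (m : ℕ) (v : ℕ → ℤ), SupportedBelow (m + 1) v →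
      SupportedBelow m ((letterRep L hL (FreeGroup.of i ^ e) : Module.End ℤ (ℕ → ℤ)) v - v) := by
    intro i e m v hv j hj
    rw [map_zpow, letterRep_of, oneAddUnit_zpow]
    simp only [LinearMap.add_apply, Module.End.one_apply, LinearMap.smul_apply, add_sub_cancel_left,
      Pi.smul_apply, letterShift_apply, hv (j + 1) (by omega), ite_self, smul_zero]
  induction f using FreeGroup.induction_on generalizing m v with
  | C1 => intro j _; simp
  | of i => simpa using key i 1 m v hv
  | inv_of i => simpa using key i (-1) m v hv
  | mul f g hf hg =>
    intro j hj
    have h1 := hg hv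
    have h2 := hf (m := m) (v := (letterRep L hL g : Module.End ℤ (ℕ → ℤ)) v) (fun i hi => by
      have := h1 i (by omega)
      rw [Pi.sub_apply, hv i hi, sub_zero] at this
      exact this)
    have := congrArg₂ (· + ·) (h1 j hj) (h2 j hj)
    simpa [Pi.sub_apply] using this

/-- The extension of `letterRep` to the group ring. -/
noncomputable def letterAlg (L : List (Fin n)) (hL : L.IsChain (· ≠ ·)) :
    MonoidAlgebra ℤ (FreeGroup (Fin n)) →ₐ[ℤ] Module.End ℤ (ℕ → ℤ) :=
  MonoidAlgebra.lift ℤ _ _ ((Units.coeHom _).comp (letterRep L hL))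

theorem letterAlg_of (L : List (Fin n)) (hL : L.IsChain (· ≠ ·)) (f : FreeGroup (Fin n)) :
    letterAlg L hL (MonoidAlgebra.of ℤ _ f) = (letterRep L hL f : Module.End ℤ (ℕ → ℤ)) := by
  rw [letterAlg, MonoidAlgebra.lift_of]
  rfl

theorem letterAlg_supportedBelow_of_mem_augSubmodule {L : List (Fin n)} (hL : L.IsChain (· ≠ ·))
    {u : MonoidAlgebra ℤ (FreeGroup (Fin n))} (hu : u ∈ augSubmodule (FreeGroup (Fin n))) {m : ℕ}
    {v : ℕ → ℤ} (hv : SupportedBelow (m + 1) v) : SupportedBelow m (letterAlg L hL u v) := by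
  replace hu := augSubmodule_le_span hu
  induction hu using Submodule.span_induction with
  | mem x hx =>
    obtain ⟨f, rfl⟩ := hx
    rw [map_sub, map_one, letterAlg_of]
    exact letterRep_sub_one hL f hv
  | zero => intro j _; simp
  | add x y hx hy h1 h2 =>
    intro j hj
    rw [map_add, LinearMap.add_apply, Pi.add_apply, h1 j hj, h2 j hj, add_zero]
  | smul r x hx h =>
    intro j hj
    rw [map_smul, LinearMap.smul_apply, Pi.smul_apply, h j hj, smul_zero]

theorem SupportedBelow.letterAlg {L : List (Fin n)} (hL : L.IsChain (· ≠ ·))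
    (u : MonoidAlgebra ℤ (FreeGroup (Fin n))) {m : ℕ} {v : ℕ → ℤ} (hv : SupportedBelow m v) :
    SupportedBelow m (letterAlg L hL u v) := by
  induction u using groupRing_induction with
  | of f =>
    intro j hj
    have h := letterRep_sub_one hL f (m := m) (v := v) (fun i hi => hv i (by omega)) j hj
    rwa [Pi.sub_apply, hv j hj, sub_zero, ← letterAlg_of] at h
  | add x y h1 h2 =>
    intro j hj
    rw [map_add, LinearMap.add_apply, Pi.add_apply, h1 j hj, h2 j hj, add_zero]
  | smul r x h =>
    intro j hj
    rw [map_smul, LinearMap.smul_apply, Pi.smul_apply, h j hj, smul_zero]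

theorem letterAlg_supportedBelow_of_mem_augPow {L : List (Fin n)} (hL : L.IsChain (· ≠ ·)) (k : ℕ)
    {u : MonoidAlgebra ℤ (FreeGroup (Fin n))} (hu : u ∈ augPow (FreeGroup (Fin n)) k) {m : ℕ}
    {v : ℕ → ℤ} (hv : SupportedBelow (m + k) v) : SupportedBelow m (letterAlg L hL u v) := by
  induction k generalizing u v with
  | zero => exact hv.letterAlg hL u
  | succ k ih =>
    induction hu using Submodule.mul_induction_on' with
    | mem_mul_mem a ha b hb =>
      rw [map_mul, Module.End.mul_apply]
      exact ih ha (letterAlg_supportedBelow_of_mem_augSubmodule hL hb hv)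
    | add a ha b hb h1 h2 =>
      intro j hj
      rw [map_add, LinearMap.add_apply, Pi.add_apply, h1 j hj, h2 j hj, add_zero]

/-- Every element of a free group is a product of syllables. -/
theorem FreeGroup.exists_syllables (f : FreeGroup (Fin n)) (hf : f ≠ 1) :
    ∃ l : List (Fin n × ℤ), l ≠ [] ∧ (∀ p ∈ l, p.2 ≠ 0) ∧ (l.map Prod.fst).IsChain (· ≠ ·) ∧
      (l.map fun p => FreeGroup.of p.1 ^ p.2).prod = f := by
  classical
  let e : FreeGroup (Fin n) ≃* Monoid.CoprodI fun _ : Fin n => FreeGroup Unit :=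
    freeGroupEquivCoprodI
  let w := Monoid.CoprodI.Word.equiv (e f)
  have hw : w.prod = e f := Monoid.CoprodI.Word.equiv.symm_apply_apply (e f)
  have hprod : (w.toList.map fun p => FreeGroup.of p.1 ^ FreeGroup.freeGroupUnitEquivInt p.2).prod
      = f := by
    apply e.injective
    rw [← hw, Monoid.CoprodI.Word.prod, map_list_prod, List.map_map]
    congr 1
    refine List.map_congr_left fun p _ => ?_
    have h2 : p.2 = FreeGroup.of () ^ FreeGroup.freeGroupUnitEquivInt p.2 :=
      (FreeGroup.freeGroupUnitEquivInt.symm_apply_apply p.2).symm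
    conv_rhs => rw [h2, map_zpow]
    rw [Function.comp_apply, map_zpow]
    congr 1
  refine ⟨w.toList.map fun p => (p.1, FreeGroup.freeGroupUnitEquivInt p.2), ?_, ?_, ?_, ?_⟩
  · intro h
    rw [List.map_eq_nil_iff] at h
    rw [h] at hprod
    exact hf hprod.symm
  · intro p hp h0
    obtain ⟨q, hq, rfl⟩ := List.mem_map.mp hp
    refine w.ne_one q hq ?_
    rw [← FreeGroup.freeGroupUnitEquivInt.symm_apply_apply q.2, show FreeGroup.freeGroupUnitEquivInt q.2 = 0 from h0]
    rfl
  · rw [List.map_map, List.isChain_map]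
    exact w.chain_ne
  · rw [List.map_map]
    exact hprod

/-- A syllable x^e acts as 1 + e·shift. To carry the unit vector at place |L| down to place |pre|,
every remaining syllable must shift exactly once, contributing its exponent. The vanishing clause
removes the contribution of the summand 1 in the induction. -/
theorem letterRep_syllables (L : List (Fin n)) (hL : L.IsChain (· ≠ ·)) (pre : List (Fin n))
    (l : List (Fin n × ℤ)) (hl : pre ++ l.map Prod.fst = L) :
    ((letterRep L hL (l.map fun p => FreeGroup.of p.1 ^ p.2).prod : Module.End ℤ (ℕ → ℤ))
        (Pi.single L.length 1) pre.length = (l.map Prod.snd).prod) ∧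
      ∀ i < pre.length, (letterRep L hL (l.map fun p => FreeGroup.of p.1 ^ p.2).prod :
        Module.End ℤ (ℕ → ℤ)) (Pi.single L.length 1) i = 0 := by
  induction l generalizing pre with
  | nil =>
    have : L = pre := by simpa using hl.symm
    subst this
    refine ⟨by simp, fun i hi => by simp [hi.ne]⟩
  | cons a l ih =>
    obtain ⟨h1, h2⟩ := ih (pre ++ [a.1]) (by simpa using hl)
    rw [List.length_append, List.length_singleton] at h1 h2
    have ha : L[pre.length]? = some a.1 := by rw [← hl]; simp
    have step : ∀ i, (letterRep L hL ((a :: l).map fun p => FreeGroup.of p.1 ^ p.2).prod :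
        Module.End ℤ (ℕ → ℤ)) (Pi.single L.length 1) i =
        (letterRep L hL (l.map fun p => FreeGroup.of p.1 ^ p.2).prod :
        Module.End ℤ (ℕ → ℤ)) (Pi.single L.length 1) i + a.2 * (if L[i]? = some a.1 then
        (letterRep L hL (l.map fun p => FreeGroup.of p.1 ^ p.2).prod :
        Module.End ℤ (ℕ → ℤ)) (Pi.single L.length 1) (i + 1) else 0) := by
      intro i
      rw [List.map_cons, List.prod_cons, map_mul, Units.val_mul, Module.End.mul_apply, map_zpow,
        letterRep_of, oneAddUnit_zpow]
      rfl
    constructor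
    · rw [step, ha, if_pos rfl, h1, h2 _ (by omega), List.map_cons, List.prod_cons, zero_add]
    · intro i hi
      rw [step, h2 i (by omega), h2 (i + 1) (by omega), ite_self, mul_zero, add_zero]

/-- The powers of the augmentation ideal detect the elements of a free group. -/
theorem FreeGroup.eq_one_of_forall_mem_augPow (f : FreeGroup (Fin n))
    (h : ∀ k, MonoidAlgebra.of ℤ _ f - 1 ∈ augPow (FreeGroup (Fin n)) k) : f = 1 := by
  by_contra hf
  obtain ⟨l, hl, hl0, hchain, rfl⟩ := FreeGroup.exists_syllables f hf
  set L := l.map Prod.fst with hLdef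
  have hpos : 0 < L.length := by
    rw [hLdef, List.length_map]
    exact List.length_pos_iff.mpr hl
  have h1 := (letterRep_syllables L hchain [] l rfl).1
  -- The unit vector at |L| is supported below |L| + 1, so f − 1 in the power |L| + 1 of I kills it.
  -- Its entry at 0 is 0, whereas f produces the nonzero product of the exponents there.
  have h2 := letterAlg_supportedBelow_of_mem_augPow hchain (L.length + 1) (h (L.length + 1)) (m := 0)
    (v := Pi.single L.length 1) (fun i hi => by rw [Pi.single_apply, if_neg (by omega)]) 0 le_rfl
  rw [map_sub, _root_.map_one, letterAlg_of, LinearMap.sub_apply, Pi.sub_apply, sub_eq_zero] at h2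
  rw [List.length_nil, h2, Module.End.one_apply, Pi.single_apply, if_neg (by omega)] at h1
  refine List.prod_ne_zero ?_ h1.symm
  intro hmem
  obtain ⟨p, hp, hp0⟩ := List.mem_map.mp hmem
  exact hl0 p hp hp0

end Faithful

/-! ### The Magnus embedding and the graded action of φ -/

section Magnus

open PowerSeries

variable {n : ℕ}

/-- The tensor algebra of the abelianization of a free group. -/
abbrev FreeAbTA (n : ℕ) : Type := TensorAlgebra ℤ (FreeAb n)

/-- The class of an element in the abelianization, written additively. -/
def abClass (f : FreeGroup (Fin n)) : FreeAb n := Additive.ofMul (Abelianization.of f)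

theorem abClass_mul (f g : FreeGroup (Fin n)) : abClass (f * g) = abClass f + abClass g := by
  rw [abClass, map_mul]; rfl

theorem abClass_one : abClass (1 : FreeGroup (Fin n)) = 0 := by
  rw [abClass, map_one]; rfl

/-- The basis of the abelianization of a free group given by the generators. -/
noncomputable def freeAbBasis (n : ℕ) : Module.Basis (Fin n) ℤ (FreeAb n) :=
  FreeAbelianGroup.basis (Fin n)

theorem freeAbBasis_apply (i : Fin n) : freeAbBasis n i = abClass (FreeGroup.of i) := by
  have h : (FreeAbelianGroup.equivFinsupp (Fin n)).symm (Finsupp.single i 1) =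
      FreeAbelianGroup.of i := by
    rw [AddEquiv.symm_apply_eq]
    exact (FreeAbelianGroup.toFinsupp_of i).symm
  exact h

/-- The words ending in the letter i occur only in the i-th summand, so the coefficient at w·i is
that of t_i at w. -/
theorem FreeAlgebra.eq_zero_of_sum_mul_ι {R ι : Type*} [CommRing R] [Fintype ι]
    (t : ι → FreeAlgebra R ι) (h : ∑ i, t i * FreeAlgebra.ι R i = 0) (i : ι) : t i = 0 := by
  classical
  apply FreeAlgebra.equivMonoidAlgebraFreeMonoid.injective
  have h' := congrArg FreeAlgebra.equivMonoidAlgebraFreeMonoid h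
  rw [map_zero, map_sum] at h'
  rw [map_zero]
  ext w
  have hw := congrArg (fun z => MonoidAlgebra.coeff z (w * FreeMonoid.of i)) h'
  have hι : ∀ j : ι, FreeAlgebra.equivMonoidAlgebraFreeMonoid (FreeAlgebra.ι R j) =
      MonoidAlgebra.single (FreeMonoid.of j) (1 : R) := by
    intro j
    simp [FreeAlgebra.equivMonoidAlgebraFreeMonoid]
  simp only [map_mul, hι] at hw
  rw [MonoidAlgebra.coeff_sum, Finsupp.finsetSum_apply, Finset.sum_eq_single i
    (fun j _ hj => MonoidAlgebra.coeff_mul_single_of_forall_mul_ne _ _ fun d hd => ?_)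
    (fun h => absurd (Finset.mem_univ i) h),
    MonoidAlgebra.coeff_mul_single_eq_coeff_mul w, mul_one] at hw
  · exact hw
  · exact fun m _ => ⟨fun h => List.append_cancel_right h, fun h => h ▸ rfl⟩
  · exact hj (List.singleton_inj.mp (List.append_inj_right' hd rfl))

theorem sum_mul_ι_eq_zero (t : Fin n → FreeAbTA n)
    (h : ∑ i, t i * TensorAlgebra.ι ℤ (abClass (FreeGroup.of i)) = 0) (i : Fin n) : t i = 0 := by
  apply (TensorAlgebra.equivFreeAlgebra (freeAbBasis n)).injective
  rw [map_zero]
  refine FreeAlgebra.eq_zero_of_sum_mul_ι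
    (fun j => TensorAlgebra.equivFreeAlgebra (freeAbBasis n) (t j)) ?_ i
  have h' := congrArg (TensorAlgebra.equivFreeAlgebra (freeAbBasis n)) h
  rw [map_zero, map_sum] at h'
  rw [← h']
  refine Finset.sum_congr rfl fun j _ => ?_
  rw [map_mul, ← freeAbBasis_apply, TensorAlgebra.equivFreeAlgebra_ι_apply]

/-- The Magnus embedding of a free group into power series over the tensor algebra. -/
noncomputable def magnus (n : ℕ) : FreeGroup (Fin n) →* (FreeAbTA n)⟦X⟧ˣ :=
  FreeGroup.lift fun i => oneAddMulX (TensorAlgebra.ι ℤ (abClass (FreeGroup.of i)))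

theorem magnus_of (i : Fin n) : (magnus n (FreeGroup.of i) : (FreeAbTA n)⟦X⟧) =
    1 + C (TensorAlgebra.ι ℤ (abClass (FreeGroup.of i))) * X := by
  rw [magnus, FreeGroup.lift_apply_of]; rfl

theorem constantCoeff_magnus (f : FreeGroup (Fin n)) :
    constantCoeff (magnus n f : (FreeAbTA n)⟦X⟧) = 1 := by
  have h : ∀ f : FreeGroup (Fin n), constantCoeff (magnus n f : (FreeAbTA n)⟦X⟧) = 1 →
      constantCoeff (magnus n f⁻¹ : (FreeAbTA n)⟦X⟧) = 1 := by
    intro f hf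
    have := congrArg constantCoeff (magnus n f).mul_inv
    rwa [map_mul, hf, one_mul, map_one, ← map_inv] at this
  induction f using FreeGroup.induction_on with
  | C1 => simp
  | of i => rw [magnus_of]; simp
  | inv_of i hi => exact h _ hi
  | mul f g hf hg => rw [map_mul, Units.val_mul, map_mul, hf, hg, one_mul]

theorem coeff_one_magnus_mul (f g : FreeGroup (Fin n)) :
    coeff 1 (magnus n (f * g) : (FreeAbTA n)⟦X⟧) = coeff 1 (magnus n f : (FreeAbTA n)⟦X⟧) +
      coeff 1 (magnus n g : (FreeAbTA n)⟦X⟧) := by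
  rw [map_mul, Units.val_mul, coeff_mul, Finset.Nat.antidiagonal_succ]
  simp [constantCoeff_magnus, add_comm]

theorem coeff_one_magnus (f : FreeGroup (Fin n)) :
    coeff 1 (magnus n f : (FreeAbTA n)⟦X⟧) = TensorAlgebra.ι ℤ (abClass f) := by
  induction f using FreeGroup.induction_on with
  | C1 => rw [map_one, abClass_one, map_zero]; simp [coeff_one]
  | of i => rw [magnus_of]; simp [coeff_one]
  | inv_of i hi =>
    have h1 := coeff_one_magnus_mul (FreeGroup.of i) (FreeGroup.of i)⁻¹
    have h2 := abClass_mul (FreeGroup.of i) (FreeGroup.of i)⁻¹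
    rw [mul_inv_cancel, abClass_one] at h2
    rw [mul_inv_cancel, hi, map_one, Units.val_one, coeff_one, if_neg one_ne_zero] at h1
    rw [eq_neg_of_add_eq_zero_right h1.symm, eq_neg_of_add_eq_zero_right h2.symm, map_neg]
  | mul f g hf hg => rw [coeff_one_magnus_mul, hf, hg, abClass_mul, map_add]

/-- The extension of the Magnus embedding to the group ring. -/
noncomputable def magnusRing (n : ℕ) : MonoidAlgebra ℤ (FreeGroup (Fin n)) →+* (FreeAbTA n)⟦X⟧ :=
  (MonoidAlgebra.lift ℤ (FreeAbTA n)⟦X⟧ (FreeGroup (Fin n))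
    ((Units.coeHom _).comp (magnus n))).toRingHom

theorem magnusRing_of (f : FreeGroup (Fin n)) :
    magnusRing n (MonoidAlgebra.of ℤ _ f) = (magnus n f : (FreeAbTA n)⟦X⟧) := by
  change MonoidAlgebra.lift ℤ (FreeAbTA n)⟦X⟧ (FreeGroup (Fin n)) _ _ = _
  rw [MonoidAlgebra.lift_of]
  rfl

theorem coeff_zero_magnusRing (u : MonoidAlgebra ℤ (FreeGroup (Fin n))) :
    coeff 0 (magnusRing n u) = algebraMap ℤ (FreeAbTA n) (groupRingAug _ u) := by
  induction u using groupRing_induction with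
  | of f => rw [magnusRing_of, groupRingAug_of, map_one, coeff_zero_eq_constantCoeff,
      constantCoeff_magnus]
  | add u v hu hv => simp only [map_add, hu, hv]
  | smul r u hu => rw [map_zsmul, map_zsmul, hu, map_smul, smul_eq_mul, map_mul, zsmul_eq_mul]; rfl

theorem coeff_magnusRing_eq_zero {k : ℕ} {u : MonoidAlgebra ℤ (FreeGroup (Fin n))}
    (hu : u ∈ augPow _ k) : ∀ j < k, coeff j (magnusRing n u) = 0 := by
  induction k generalizing u with
  | zero => intro j hj; omega
  | succ k ih =>
    induction hu using Submodule.mul_induction_on' with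
    | mem_mul_mem a ha b hb =>
      intro j hj
      rw [map_mul]
      refine coeff_mul_eq_zero (b := 1) (ih ha) (fun i hi => ?_) hj
      rw [Nat.lt_one_iff.mp hi, coeff_zero_magnusRing, mem_augSubmodule.mp hb, map_zero]
    | add a ha b hb h1 h2 =>
      intro j hj
      rw [map_add, map_add, h1 j hj, h2 j hj, add_zero]

theorem coeff_succ_magnusRing_mul {k : ℕ} {u v : MonoidAlgebra ℤ (FreeGroup (Fin n))}
    (hu : u ∈ augPow _ k) (hv : v ∈ augSubmodule (FreeGroup (Fin n))) :
    coeff (k + 1) (magnusRing n (u * v)) =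
      coeff k (magnusRing n u) * coeff 1 (magnusRing n v) := by
  rw [map_mul]
  refine coeff_add_mul (coeff_magnusRing_eq_zero hu) (fun i hi => ?_)
  rw [Nat.lt_one_iff.mp hi, coeff_zero_magnusRing, mem_augSubmodule.mp hv, map_zero]

/-- The endomorphism of the tensor algebra induced by an automorphism of the free group. -/
noncomputable def tensorAlgAut (φ : MulAut (FreeGroup (Fin n))) : FreeAbTA n →ₐ[ℤ] FreeAbTA n :=
  TensorAlgebra.lift ℤ ((TensorAlgebra.ι ℤ).comp (abAut φ).toLinearMap)

theorem tensorAlgAut_ι (φ : MulAut (FreeGroup (Fin n))) (v : FreeAb n) :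
    tensorAlgAut φ (TensorAlgebra.ι ℤ v) = TensorAlgebra.ι ℤ (abAut φ v) := by
  rw [tensorAlgAut, TensorAlgebra.lift_ι_apply]; rfl

theorem coeff_one_magnusRing_map (φ : MulAut (FreeGroup (Fin n)))
    {u : MonoidAlgebra ℤ (FreeGroup (Fin n))} (hu : u ∈ augSubmodule (FreeGroup (Fin n))) :
    coeff 1 (magnusRing n (groupRingMap φ.toMonoidHom u)) =
      tensorAlgAut φ (coeff 1 (magnusRing n u)) := by
  replace hu := augSubmodule_le_span hu
  induction hu using Submodule.span_induction with
  | mem x hx =>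
    obtain ⟨f, rfl⟩ := hx
    have h1 : coeff 1 (1 : (FreeAbTA n)⟦X⟧) = 0 := by simp [coeff_one]
    simp only [map_sub, map_one, groupRingMap_of, magnusRing_of, coeff_one_magnus, h1,
      sub_zero, tensorAlgAut_ι]
    rfl
  | zero => simp
  | add x y hx hy h1 h2 => simp only [map_add, h1, h2]
  | smul r x hx h => simp only [map_zsmul, h]

/-- The Magnus map depends on the chosen generators and need not commute with φ. On the k-th power
of I, however, the degree-k coefficient is multiplicative in the factors from I, and in degree 1 it
is the class in F^ab, which is natural. -/
theorem coeff_magnusRing_map (φ : MulAut (FreeGroup (Fin n))) {k : ℕ}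
    {u : MonoidAlgebra ℤ (FreeGroup (Fin n))} (hu : u ∈ augPow (FreeGroup (Fin n)) k) :
    coeff k (magnusRing n (groupRingMap φ.toMonoidHom u)) =
      tensorAlgAut φ (coeff k (magnusRing n u)) := by
  induction k generalizing u with
  | zero =>
    rw [coeff_zero_magnusRing, coeff_zero_magnusRing, groupRingAug_groupRingMap, AlgHom.commutes]
  | succ k ih =>
    induction hu using Submodule.mul_induction_on' with
    | mem_mul_mem a ha b hb =>
      rw [map_mul, coeff_succ_magnusRing_mul (groupRingMap_mem_augPow _ _ ha)
        (groupRingMap_mem_augSubmodule _ hb), ih ha, coeff_one_magnusRing_map φ hb,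
        coeff_succ_magnusRing_mul ha hb, map_mul]
    | add a ha b hb h1 h2 => simp only [map_add, h1, h2]

/-- The v_i are Fox derivatives; the product case is fg − 1 = (f − 1) + f(g − 1). -/
theorem exists_eq_aug_add_sum (u : MonoidAlgebra ℤ (FreeGroup (Fin n))) :
    ∃ v : Fin n → MonoidAlgebra ℤ (FreeGroup (Fin n)),
      u = groupRingAug _ u • 1 + ∑ i, v i * (MonoidAlgebra.of ℤ _ (FreeGroup.of i) - 1) := by
  classical
  induction u using groupRing_induction with
  | of f =>
    rw [groupRingAug_of, one_smul]
    induction f using FreeGroup.induction_on with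
    | C1 => exact ⟨0, by rw [map_one]; simp⟩
    | of i =>
      refine ⟨Pi.single i 1, ?_⟩
      rw [Finset.sum_eq_single i (fun j _ hj => by rw [Pi.single_eq_of_ne hj, zero_mul])
        (fun h => absurd (Finset.mem_univ i) h), Pi.single_eq_same, one_mul]
      abel
    | inv_of i hi =>
      refine ⟨Pi.single i (-MonoidAlgebra.of ℤ _ (FreeGroup.of i)⁻¹), ?_⟩
      rw [Finset.sum_eq_single i (fun j _ hj => by rw [Pi.single_eq_of_ne hj, zero_mul])
        (fun h => absurd (Finset.mem_univ i) h), Pi.single_eq_same, neg_mul, mul_sub, ← map_mul,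
        inv_mul_cancel, map_one, mul_one]
      abel
    | mul f g hf hg =>
      obtain ⟨v, hv⟩ := hf
      obtain ⟨w, hw⟩ := hg
      refine ⟨fun i => v i + MonoidAlgebra.of ℤ _ f * w i, ?_⟩
      rw [map_mul]
      conv_lhs => rw [hw, mul_add, mul_one, Finset.mul_sum]
      conv_lhs => enter [1]; rw [hv]
      simp only [add_mul, Finset.sum_add_distrib, mul_assoc]
      abel
  | add u v hu hv =>
    obtain ⟨a, ha⟩ := hu
    obtain ⟨b, hb⟩ := hv
    refine ⟨fun i => a i + b i, ?_⟩
    conv_lhs => rw [ha, hb]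
    simp only [map_add, add_mul, Finset.sum_add_distrib, add_smul]
    abel
  | smul r u hu =>
    obtain ⟨a, ha⟩ := hu
    refine ⟨fun i => r • a i, ?_⟩
    conv_lhs => rw [ha]
    simp only [map_smul, smul_mul_assoc, ← Finset.smul_sum, smul_add, smul_assoc]

theorem coeff_succ_magnusRing_of_eq {u : MonoidAlgebra ℤ (FreeGroup (Fin n))} {r : ℤ}
    {v : Fin n → MonoidAlgebra ℤ (FreeGroup (Fin n))}
    (h : u = r • 1 + ∑ i, v i * (MonoidAlgebra.of ℤ _ (FreeGroup.of i) - 1)) (j : ℕ) :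
    coeff (j + 1) (magnusRing n u) =
      ∑ i, coeff j (magnusRing n (v i)) * TensorAlgebra.ι ℤ (abClass (FreeGroup.of i)) := by
  have h1 : coeff (j + 1) (1 : (FreeAbTA n)⟦X⟧) = 0 := by simp [coeff_one]
  rw [h, map_add, map_zsmul, map_one, map_add, map_zsmul, h1, smul_zero, zero_add, map_sum, map_sum]
  refine Finset.sum_congr rfl fun i _ => ?_
  rw [map_mul, map_sub, map_one, magnusRing_of, magnus_of, add_sub_cancel_left, ← mul_assoc,
    coeff_succ_mul_X, coeff_mul_C]

/-- Induction through Fox derivatives: by freeness of the tensor algebra, vanishing of u in degree j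
+ 1 forces each v_i to vanish in degree j. -/
theorem mem_augPow_of_coeff_eq_zero {k : ℕ} {u : MonoidAlgebra ℤ (FreeGroup (Fin n))}
    (h : ∀ j < k, coeff j (magnusRing n u) = 0) : u ∈ augPow (FreeGroup (Fin n)) k := by
  induction k generalizing u with
  | zero => trivial
  | succ k ih =>
    obtain ⟨v, hv⟩ := exists_eq_aug_add_sum u
    have h0 : groupRingAug _ u = 0 := by
      have := h 0 k.succ_pos
      rwa [coeff_zero_magnusRing, map_eq_zero_iff _ (TensorAlgebra.algebraMap_leftInverse _).injective]
        at this
    have hcoeff := coeff_succ_magnusRing_of_eq hv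
    rw [h0, zero_smul, zero_add] at hv
    rw [hv]
    refine Submodule.sum_mem _ fun i _ => Submodule.mul_mem_mul (ih fun j hj => ?_)
      (of_sub_one_mem_augSubmodule _)
    exact sum_mul_ι_eq_zero _ ((hcoeff j).symm.trans (h (j + 1) (by omega))) i

theorem toTensorAlgebra_injective (k : ℕ) : Function.Injective
    (TensorPower.toTensorAlgebra : (⨂[ℤ]^k (FreeAb n)) →ₗ[ℤ] FreeAbTA n) := by
  intro x y hxy
  have key : ∀ z : ⨂[ℤ]^k (FreeAb n), TensorPower.toTensorAlgebra z =
      TensorAlgebra.ofDirectSum (DirectSum.of (fun k => ⨂[ℤ]^k (FreeAb n)) k z) := fun z =>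
    (DirectSum.toAddMonoid_of
      (fun _ ↦ LinearMap.toAddMonoidHom TensorPower.toTensorAlgebra) _ _).symm
  rw [key, key] at hxy
  exact DirectSum.of_injective k (TensorAlgebra.equivDirectSum.symm.injective hxy)

theorem tensorAlgAut_toTensorAlgebra (φ : MulAut (FreeGroup (Fin n))) (k : ℕ)
    (t : ⨂[ℤ]^k (FreeAb n)) : tensorAlgAut φ (TensorPower.toTensorAlgebra t) =
      TensorPower.toTensorAlgebra (PiTensorProduct.congr (R := ℤ) (fun _ : Fin k => abAut φ) t) := by
  induction t using PiTensorProduct.induction_on with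
  | smul_tprod r x =>
    rw [map_smul, map_smul, map_smul, map_smul, PiTensorProduct.congr_tprod,
      TensorPower.toTensorAlgebra_tprod, TensorPower.toTensorAlgebra_tprod,
      TensorAlgebra.tprod_apply, TensorAlgebra.tprod_apply, map_list_prod, List.map_ofFn]
    simp only [Function.comp_def, tensorAlgAut_ι]
  | add x y hx hy => simp only [map_add, hx, hy]

/-- Leading terms must be honest elements of the tensor power, where the hypothesis of residual
nilpotence applies. -/
theorem coeff_magnusRing_mem_range (k : ℕ) (u : MonoidAlgebra ℤ (FreeGroup (Fin n))) :
    coeff k (magnusRing n u) ∈ LinearMap.range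
      (TensorPower.toTensorAlgebra : (⨂[ℤ]^k (FreeAb n)) →ₗ[ℤ] FreeAbTA n) := by
  induction k generalizing u with
  | zero =>
    rw [coeff_zero_magnusRing, ← TensorPower.toTensorAlgebra_galgebra_toFun]
    exact LinearMap.mem_range_self _ _
  | succ k ih =>
    obtain ⟨v, hv⟩ := exists_eq_aug_add_sum u
    rw [coeff_succ_magnusRing_of_eq hv]
    refine Submodule.sum_mem _ fun i _ => ?_
    obtain ⟨t, ht⟩ := ih (v i)
    have h1 : TensorAlgebra.ι ℤ (abClass (FreeGroup.of i)) = TensorPower.toTensorAlgebra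
        (PiTensorProduct.tprod ℤ fun _ : Fin 1 => abClass (FreeGroup.of i)) := by
      rw [TensorPower.toTensorAlgebra_tprod]
      simp [TensorAlgebra.tprod_apply]
    rw [← ht, h1, ← TensorPower.toTensorAlgebra_gMul]
    exact LinearMap.mem_range_self _ _

end Magnus

/-! ### The filtration of the free group by Magnus degree -/

section DimensionSeries

open PowerSeries

variable {n : ℕ}

/-- The Magnus series of `f` is `1` up to terms of degree at least `k`. -/
def MagnusTrivialBelow (k : ℕ) (f : FreeGroup (Fin n)) : Prop :=
  ∀ j < k, coeff j ((magnus n f : (FreeAbTA n)⟦X⟧) - 1) = 0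

/-- The coefficient in degree `k` of the Magnus series of `f` minus one. -/
noncomputable def magnusCoeff (k : ℕ) (f : FreeGroup (Fin n)) : FreeAbTA n :=
  coeff k ((magnus n f : (FreeAbTA n)⟦X⟧) - 1)

theorem magnusRing_of_sub_one (f : FreeGroup (Fin n)) :
    magnusRing n (MonoidAlgebra.of ℤ _ f - 1) = (magnus n f : (FreeAbTA n)⟦X⟧) - 1 := by
  rw [map_sub, magnusRing_of, map_one]

theorem magnusTrivialBelow_iff {k : ℕ} {f : FreeGroup (Fin n)} :
    MagnusTrivialBelow k f ↔ MonoidAlgebra.of ℤ _ f - 1 ∈ augPow (FreeGroup (Fin n)) k := by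
  rw [MagnusTrivialBelow, ← magnusRing_of_sub_one]
  exact ⟨mem_augPow_of_coeff_eq_zero, coeff_magnusRing_eq_zero⟩

theorem magnusTrivialBelow_one (f : FreeGroup (Fin n)) : MagnusTrivialBelow 1 f := by
  intro j hj
  rw [Nat.lt_one_iff.mp hj, coeff_zero_eq_constantCoeff, map_sub, constantCoeff_magnus, map_one,
    sub_self]

theorem MagnusTrivialBelow.succ {k : ℕ} {f : FreeGroup (Fin n)} (h : MagnusTrivialBelow k f)
    (h0 : magnusCoeff k f = 0) : MagnusTrivialBelow (k + 1) f := by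
  intro j hj
  rcases (Nat.lt_succ_iff.mp hj).lt_or_eq with hj | rfl
  · exact h j hj
  · exact h0

/-- The cross term (f − 1)(g − 1) starts in degree 2k, which exceeds k because k ≥ 1. -/
theorem coeff_magnus_mul_sub_one {k : ℕ} (hk : 1 ≤ k) {f g : FreeGroup (Fin n)}
    (hf : MagnusTrivialBelow k f) (hg : MagnusTrivialBelow k g) {j : ℕ} (hj : j ≤ k) :
    magnusCoeff j (f * g) = magnusCoeff j f + magnusCoeff j g := by
  have h : (magnus n (f * g) : (FreeAbTA n)⟦X⟧) - 1 =
      ((magnus n f : (FreeAbTA n)⟦X⟧) - 1) + ((magnus n g : (FreeAbTA n)⟦X⟧) - 1) +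
      ((magnus n f : (FreeAbTA n)⟦X⟧) - 1) * ((magnus n g : (FreeAbTA n)⟦X⟧) - 1) := by
    rw [map_mul, Units.val_mul, sub_mul, mul_sub, mul_sub, one_mul, mul_one]
    simp
  rw [magnusCoeff, h, map_add, map_add, coeff_mul_eq_zero hf hg (by omega), add_zero]
  rfl

theorem MagnusTrivialBelow.mul {k : ℕ} (hk : 1 ≤ k) {f g : FreeGroup (Fin n)}
    (hf : MagnusTrivialBelow k f) (hg : MagnusTrivialBelow k g) : MagnusTrivialBelow k (f * g) := by
  intro j hj
  have h := coeff_magnus_mul_sub_one hk hf hg hj.le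
  rw [magnusCoeff, magnusCoeff, magnusCoeff, hf j hj, hg j hj, add_zero] at h
  exact h

theorem MagnusTrivialBelow.inv {k : ℕ} {f : FreeGroup (Fin n)}
    (hf : MagnusTrivialBelow k f) : MagnusTrivialBelow k f⁻¹ := by
  intro j hj
  have h : (magnus n f⁻¹ : (FreeAbTA n)⟦X⟧) - 1 =
      (-(magnus n f⁻¹ : (FreeAbTA n)⟦X⟧)) * ((magnus n f : (FreeAbTA n)⟦X⟧) - 1) := by
    rw [neg_mul, mul_sub, mul_one, ← Units.val_mul, ← map_mul, inv_mul_cancel, map_one,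
      Units.val_one, neg_sub]
  rw [h]
  exact coeff_mul_eq_zero (a := 0) (by simp) hf (by omega)

theorem magnusCoeff_one (k : ℕ) : magnusCoeff k (1 : FreeGroup (Fin n)) = 0 := by
  rw [magnusCoeff, map_one, Units.val_one, sub_self, map_zero]

theorem magnusCoeff_inv {k : ℕ} (hk : 1 ≤ k) {f : FreeGroup (Fin n)}
    (hf : MagnusTrivialBelow k f) : magnusCoeff k f⁻¹ = -magnusCoeff k f := by
  have h := coeff_magnus_mul_sub_one hk hf hf.inv le_rfl
  rw [mul_inv_cancel, magnusCoeff_one] at h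
  exact eq_neg_of_add_eq_zero_right h.symm

theorem magnus_conj_sub_one (a f : FreeGroup (Fin n)) :
    (magnus n (a * f * a⁻¹) : (FreeAbTA n)⟦X⟧) - 1 = (magnus n a : (FreeAbTA n)⟦X⟧) *
      ((magnus n f : (FreeAbTA n)⟦X⟧) - 1) * (magnus n a⁻¹ : (FreeAbTA n)⟦X⟧) := by
  rw [mul_sub, mul_one, sub_mul, ← Units.val_mul, ← Units.val_mul, ← Units.val_mul, ← map_mul,
    ← map_mul, ← map_mul, mul_inv_cancel, map_one, Units.val_one]

theorem MagnusTrivialBelow.conj {k : ℕ} {f : FreeGroup (Fin n)}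
    (hf : MagnusTrivialBelow k f) (a : FreeGroup (Fin n)) : MagnusTrivialBelow k (a * f * a⁻¹) := by
  intro j hj
  rw [magnus_conj_sub_one]
  exact coeff_mul_eq_zero (b := 0)
    (fun i hi => coeff_mul_eq_zero (a := 0) (by simp) hf (by omega)) (by simp) hj

/-- The conjugating series have constant term 1, so the lowest term is untouched. -/
theorem magnusCoeff_conj {k : ℕ} {f : FreeGroup (Fin n)}
    (hf : MagnusTrivialBelow k f) (a : FreeGroup (Fin n)) :
    magnusCoeff k (a * f * a⁻¹) = magnusCoeff k f := by
  have h1 := coeff_add_mul (a := 0) (b := k) (f := (magnus n a : (FreeAbTA n)⟦X⟧)) (by simp) hf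
  have h2 := coeff_add_mul (a := k) (b := 0)
    (f := (magnus n a : (FreeAbTA n)⟦X⟧) * ((magnus n f : (FreeAbTA n)⟦X⟧) - 1))
    (g := (magnus n a⁻¹ : (FreeAbTA n)⟦X⟧))
    (fun i hi => coeff_mul_eq_zero (a := 0) (by simp) hf (by omega)) (by simp)
  rw [coeff_zero_eq_constantCoeff, constantCoeff_magnus, one_mul, zero_add] at h1
  rw [coeff_zero_eq_constantCoeff, constantCoeff_magnus, mul_one, add_zero, h1] at h2
  rw [magnusCoeff, magnus_conj_sub_one, h2, magnusCoeff]

theorem groupRingMap_of_sub_one (φ : MulAut (FreeGroup (Fin n))) (f : FreeGroup (Fin n)) :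
    groupRingMap φ.toMonoidHom (MonoidAlgebra.of ℤ _ f - 1) = MonoidAlgebra.of ℤ _ (φ f) - 1 := by
  rw [map_sub, map_one, groupRingMap_of]
  rfl

theorem MagnusTrivialBelow.map {k : ℕ} {f : FreeGroup (Fin n)}
    (hf : MagnusTrivialBelow k f) (φ : MulAut (FreeGroup (Fin n))) :
    MagnusTrivialBelow k (φ f) := by
  rw [magnusTrivialBelow_iff] at *
  rw [← groupRingMap_of_sub_one]
  exact groupRingMap_mem_augPow _ k hf

theorem magnusCoeff_map {k : ℕ} {f : FreeGroup (Fin n)}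
    (hf : MagnusTrivialBelow k f) (φ : MulAut (FreeGroup (Fin n))) :
    magnusCoeff k (φ f) = tensorAlgAut φ (magnusCoeff k f) := by
  rw [magnusTrivialBelow_iff] at hf
  have h := coeff_magnusRing_map φ hf
  rwa [groupRingMap_of_sub_one, magnusRing_of_sub_one, magnusRing_of_sub_one] at h

theorem FreeGroup.eq_one_of_forall_magnusTrivialBelow {f : FreeGroup (Fin n)}
    (h : ∀ k, MagnusTrivialBelow k f) : f = 1 :=
  FreeGroup.eq_one_of_forall_mem_augPow f fun k => magnusTrivialBelow_iff.mp (h k)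

theorem MagnusTrivialBelow.mem_commutator {f : FreeGroup (Fin n)} (h : MagnusTrivialBelow 2 f) :
    f ∈ commutator (FreeGroup (Fin n)) := by
  have h1 := h 1 one_lt_two
  rw [map_sub, coeff_one_magnus, coeff_one, if_neg one_ne_zero, sub_zero] at h1
  have h2 : abClass f = 0 := TensorAlgebra.ι_leftInverse.injective (h1.trans (map_zero _).symm)
  have h3 : Abelianization.of f = 1 := h2
  rw [← MonoidHom.mem_ker] at h3
  rwa [Abelianization.ker_of] at h3

end DimensionSeries

/-! ### The operator Ω = φ̄_k − 1 on tensor powers -/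

section TensorPowerAction

open scoped commutatorElement

variable {n : ℕ}

/-- The automorphism of the `k`-th tensor power as a linear endomorphism. -/
noncomputable def tensorPowEquiv (φ : MulAut (FreeGroup (Fin n))) (k : ℕ) :
    (⨂[ℤ]^k (FreeAb n)) ≃ₗ[ℤ] (⨂[ℤ]^k (FreeAb n)) :=
  PiTensorProduct.congr (R := ℤ) (fun _ : Fin k => abAut φ)

/-- The difference of the automorphism of the `k`-th tensor power and the identity. -/
noncomputable def tensorPowDiff (φ : MulAut (FreeGroup (Fin n))) (k : ℕ) :
    Module.End ℤ (⨂[ℤ]^k (FreeAb n)) :=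
  (tensorPowEquiv φ k).toLinearMap - 1

theorem abClass_surjective : Function.Surjective (abClass : FreeGroup (Fin n) → FreeAb n) :=
  fun v => QuotientGroup.mk'_surjective _ (Additive.toMul v)

theorem tensorAlgAut_mul (φ ψ : MulAut (FreeGroup (Fin n))) (t : FreeAbTA n) :
    tensorAlgAut (φ * ψ) t = tensorAlgAut φ (tensorAlgAut ψ t) := by
  have h : tensorAlgAut (φ * ψ) = (tensorAlgAut φ).comp (tensorAlgAut ψ) := by
    refine TensorAlgebra.hom_ext (LinearMap.ext fun v => ?_)
    change tensorAlgAut (φ * ψ) (TensorAlgebra.ι ℤ v) =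
      tensorAlgAut φ (tensorAlgAut ψ (TensorAlgebra.ι ℤ v))
    rw [tensorAlgAut_ι, tensorAlgAut_ι, tensorAlgAut_ι]
    obtain ⟨f, rfl⟩ := abClass_surjective v
    rfl
  rw [h]; rfl

theorem tensorAlgAut_one (t : FreeAbTA n) :
    tensorAlgAut (1 : MulAut (FreeGroup (Fin n))) t = t := by
  have h : tensorAlgAut (1 : MulAut (FreeGroup (Fin n))) = AlgHom.id ℤ _ := by
    refine TensorAlgebra.hom_ext (LinearMap.ext fun v => ?_)
    change tensorAlgAut 1 (TensorAlgebra.ι ℤ v) = TensorAlgebra.ι ℤ v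
    rw [tensorAlgAut_ι]
    obtain ⟨f, rfl⟩ := abClass_surjective v
    rfl
  rw [h]; rfl

theorem tensorAlgAut_inv_toTensorAlgebra (φ : MulAut (FreeGroup (Fin n))) (k : ℕ)
    (t : ⨂[ℤ]^k (FreeAb n)) : tensorAlgAut φ⁻¹ (TensorPower.toTensorAlgebra t) =
      TensorPower.toTensorAlgebra ((tensorPowEquiv φ k).symm t) := by
  have h := tensorAlgAut_toTensorAlgebra φ k ((tensorPowEquiv φ k).symm t)
  rw [← tensorPowEquiv, LinearEquiv.apply_symm_apply] at h
  rw [← h, ← tensorAlgAut_mul, inv_mul_cancel, tensorAlgAut_one]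

/-- Every power of E = φ̄_k is 1 + qΩ with q a polynomial in E and its inverse: the inductive
witnesses come from (1 + qΩ)E = 1 + (1 + qE)Ω and E⁻¹ = 1 − E⁻¹Ω. -/
theorem exists_tensorAlgAut_zpow (φ : MulAut (FreeGroup (Fin n))) (k : ℕ) (z : ℤ) :
    ∃ q : Module.End ℤ (⨂[ℤ]^k (FreeAb n)), Commute q (tensorPowDiff φ k) ∧
      ∀ t, tensorAlgAut (φ ^ z) (TensorPower.toTensorAlgebra t) =
        TensorPower.toTensorAlgebra (t + q (tensorPowDiff φ k t)) := by
  set e := tensorPowEquiv φ k with he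
  set E : Module.End ℤ (⨂[ℤ]^k (FreeAb n)) := e.toLinearMap with hE
  set E' : Module.End ℤ (⨂[ℤ]^k (FreeAb n)) := e.symm.toLinearMap with hE'
  have hEE' : E * E' = 1 := LinearMap.ext fun t => e.apply_symm_apply t
  have hE'E : E' * E = 1 := LinearMap.ext fun t => e.symm_apply_apply t
  have hΩ : tensorPowDiff φ k = E - 1 := rfl
  have hcE : Commute E (E - 1) := (Commute.refl E).sub_right (Commute.one_right E)
  have hcE' : Commute E' (E - 1) :=
    Commute.sub_right (hE'E.trans hEE'.symm) (Commute.one_right E')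
  rw [hΩ]
  induction z with
  | zero =>
    refine ⟨0, Commute.zero_left _, fun t => ?_⟩
    rw [zpow_zero, tensorAlgAut_one, LinearMap.zero_apply, add_zero]
  | succ z ih =>
    obtain ⟨q, hq, hqt⟩ := ih
    refine ⟨1 + q * E, (Commute.one_left _).add_left (hq.mul_left hcE), fun t => ?_⟩
    rw [zpow_add_one, tensorAlgAut_mul, tensorAlgAut_toTensorAlgebra]
    change tensorAlgAut _ (TensorPower.toTensorAlgebra (E t)) = _
    rw [hqt]
    congr 1
    simp only [LinearMap.add_apply, Module.End.mul_apply, LinearMap.sub_apply, Module.End.one_apply,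
      map_sub]
    abel
  | pred z ih =>
    obtain ⟨q, hq, hqt⟩ := ih
    refine ⟨-E' + q * E', hcE'.neg_left.add_left (hq.mul_left hcE'), fun t => ?_⟩
    rw [zpow_sub_one, tensorAlgAut_mul, tensorAlgAut_inv_toTensorAlgebra]
    change tensorAlgAut _ (TensorPower.toTensorAlgebra (E' t)) = _
    rw [hqt]
    congr 1
    have h1 : E (E' t) = t := LinearMap.congr_fun hEE' t
    have h2 : E' (E t) = t := LinearMap.congr_fun hE'E t
    simp only [LinearMap.add_apply, Module.End.mul_apply, LinearMap.sub_apply, Module.End.one_apply,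
      map_sub, LinearMap.neg_apply, h1, h2]
    abel

/-- The commutator of the generator of ℤ with y is φ̄_k(y) − y = Ωy. -/
theorem inl_tensorPowDiff_pow_mem (φ : MulAut (FreeGroup (Fin n))) (k m : ℕ)
    (t : ⨂[ℤ]^k (FreeAb n)) :
    (SemidirectProduct.inl (Multiplicative.ofAdd ((tensorPowDiff φ k ^ m) t)) :
      CyclicExt (FreeAbTensor n k) (tensorAut φ k)) ∈
      (⊤ : Subgroup (CyclicExt (FreeAbTensor n k) (tensorAut φ k))).lowerCentralSeries m := by
  induction m with
  | zero => trivial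
  | succ m ih =>
    set y := (tensorPowDiff φ k ^ m) t with hy
    rw [pow_succ', Module.End.mul_apply, ← hy, Subgroup.lowerCentralSeries_succ,
      Subgroup.commutator_comm]
    have h : (SemidirectProduct.inl (Multiplicative.ofAdd (tensorPowDiff φ k y)) :
        CyclicExt (FreeAbTensor n k) (tensorAut φ k)) =
        ⁅(SemidirectProduct.inr (Multiplicative.ofAdd (1 : ℤ)) :
          CyclicExt (FreeAbTensor n k) (tensorAut φ k)),
          (SemidirectProduct.inl (Multiplicative.ofAdd y) :
          CyclicExt (FreeAbTensor n k) (tensorAut φ k))⁆ := by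
      rw [commutatorElement_def, ← map_inv, ← SemidirectProduct.inl_aut, ← map_inv, ← map_mul]
      congr 1
    rw [h]
    exact Subgroup.commutator_mem_commutator (Subgroup.mem_top _) ih

theorem eq_zero_of_forall_mem_range_tensorPowDiff_pow {φ : MulAut (FreeGroup (Fin n))} {k : ℕ}
    (h : ResiduallyNilpotent (CyclicExt (FreeAbTensor n k) (tensorAut φ k)))
    {t : ⨂[ℤ]^k (FreeAb n)} (ht : ∀ m : ℕ, ∃ s, t = (tensorPowDiff φ k ^ m) s) : t = 0 := by
  have h1 := h.iInf_lowerCentralSeries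
    (x := SemidirectProduct.inl (Multiplicative.ofAdd t : FreeAbTensor n k)) fun m => by
      obtain ⟨s, rfl⟩ := ht m
      exact inl_tensorPowDiff_pow_mem φ k m s
  exact Multiplicative.ofAdd.injective
    (SemidirectProduct.inl_injective (h1.trans (map_one SemidirectProduct.inl).symm))

end TensorPowerAction

/-! ### Descent of the series of F_n ⋊ ℤ through the filtration -/

section CyclicExtension

open scoped commutatorElement

variable {n : ℕ}

/-- The elements of the free group in `CyclicExt` whose Magnus series starts in degree `k`, with
leading term in the image of the `m`-th power of `tensorPowDiff`. -/
noncomputable def leadSubgroup (φ : MulAut (FreeGroup (Fin n))) (k m : ℕ) (hk : 1 ≤ k) :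
    Subgroup (CyclicExt (FreeGroup (Fin n)) φ) where
  carrier := {x | ∃ f, SemidirectProduct.inl f = x ∧ MagnusTrivialBelow k f ∧
    ∃ t : ⨂[ℤ]^k (FreeAb n),
      magnusCoeff k f = TensorPower.toTensorAlgebra ((tensorPowDiff φ k ^ m) t)}
  one_mem' := ⟨1, map_one _, fun j _ => magnusCoeff_one j, 0, by
    rw [magnusCoeff_one, map_zero, map_zero]⟩
  mul_mem' := by
    rintro _ _ ⟨f, rfl, hf, s, hs⟩ ⟨g, rfl, hg, t, ht⟩
    exact ⟨f * g, map_mul _ _ _, hf.mul hk hg, s + t, by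
      rw [coeff_magnus_mul_sub_one hk hf hg le_rfl, hs, ht, map_add, map_add]⟩
  inv_mem' := by
    rintro _ ⟨f, rfl, hf, s, hs⟩
    exact ⟨f⁻¹, map_inv _ _, hf.inv, -s, by rw [magnusCoeff_inv hk hf, hs, map_neg, map_neg]⟩

theorem commutator_inl (φ : MulAut (FreeGroup (Fin n))) (f : FreeGroup (Fin n))
    (g : CyclicExt (FreeGroup (Fin n)) φ) :
    ⁅(SemidirectProduct.inl f : FreeGroup (Fin n) ⋊[zpowersHom _ φ] Multiplicative ℤ), g⁆ =
      SemidirectProduct.inl (f * (g.left * (φ ^ (Multiplicative.toAdd g.right)) f⁻¹ *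
        g.left⁻¹)) := by
  have h : (SemidirectProduct.inl ((φ ^ (Multiplicative.toAdd g.right)) f⁻¹) :
      CyclicExt (FreeGroup (Fin n)) φ) = SemidirectProduct.inr g.right *
      SemidirectProduct.inl f⁻¹ * SemidirectProduct.inr g.right⁻¹ := by
    rw [← SemidirectProduct.inl_aut, zpowersHom_apply]
  rw [map_mul, map_mul, map_mul, h, commutatorElement_def]
  conv_lhs => rw [← SemidirectProduct.inl_left_mul_inr_right g]
  simp only [mul_inv_rev, map_inv, mul_assoc]

/-- For g = (a, z), the commutator [f, g] is f times a conjugate of φ^z(f⁻¹). Its degree-k term is s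
− φ̄_k^z(s) = −qΩs, where s is that of f, and q commutes with Ω. -/
theorem commutator_leadSubgroup_le (φ : MulAut (FreeGroup (Fin n))) {k : ℕ} (m : ℕ) (hk : 1 ≤ k) :
    ⁅leadSubgroup φ k m hk, (⊤ : Subgroup (CyclicExt (FreeGroup (Fin n)) φ))⁆ ≤
      leadSubgroup φ k (m + 1) hk := by
  rw [Subgroup.commutator_le]
  rintro _ ⟨f, rfl, hf, t, ht⟩ g -
  obtain ⟨q, hq, hqt⟩ := exists_tensorAlgAut_zpow φ k (Multiplicative.toAdd g.right)
  have h1 := (hf.inv.map (φ ^ (Multiplicative.toAdd g.right)))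
  refine ⟨_, (commutator_inl φ f g).symm, hf.mul hk (h1.conj g.left), -q t, ?_⟩
  rw [coeff_magnus_mul_sub_one hk hf (h1.conj _) le_rfl, magnusCoeff_conj h1,
    magnusCoeff_map hf.inv, magnusCoeff_inv hk hf, ht, map_neg, hqt, map_add, map_neg, map_neg,
    ← Module.End.mul_apply, ← Module.End.mul_apply, ← Module.End.mul_apply,
    mul_assoc, ← pow_succ', (hq.pow_right (m + 1)).eq]
  abel

theorem transLCS_le_leadSubgroup (φ : MulAut (FreeGroup (Fin n))) {k : ℕ} (hk : 1 ≤ k)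
    {α : Ordinal.{0}} (hα : 1 ≤ α)
    (h : ∀ x ∈ transLCS (CyclicExt (FreeGroup (Fin n)) φ) α,
      ∃ f, SemidirectProduct.inl f = x ∧ MagnusTrivialBelow k f) (m : ℕ) :
    transLCS (CyclicExt (FreeGroup (Fin n)) φ) (α + m) ≤ leadSubgroup φ k m hk := by
  induction m with
  | zero =>
    intro x hx
    rw [Nat.cast_zero, add_zero] at hx
    obtain ⟨f, hf, hfk⟩ := h x hx
    obtain ⟨t, ht⟩ := coeff_magnusRing_mem_range k (MonoidAlgebra.of ℤ _ f - 1)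
    rw [magnusRing_of_sub_one] at ht
    exact ⟨f, hf, hfk, t, by rw [pow_zero, Module.End.one_apply, ht, magnusCoeff]⟩
  | succ m ih =>
    rw [Nat.cast_succ, ← add_assoc, transLCS_add_one _ (hα.trans le_self_add)]
    exact (Subgroup.commutator_mono ih le_rfl).trans (commutator_leadSubgroup_le φ m hk)

theorem exists_magnusTrivialBelow_succ {φ : MulAut (FreeGroup (Fin n))} {k : ℕ} (hk : 1 ≤ k)
    (hres : ResiduallyNilpotent (CyclicExt (FreeAbTensor n k) (tensorAut φ k)))
    {α : Ordinal.{0}} (hα : 1 ≤ α)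
    (h : ∀ x ∈ transLCS (CyclicExt (FreeGroup (Fin n)) φ) α,
      ∃ f, SemidirectProduct.inl f = x ∧ MagnusTrivialBelow k f)
    {x : CyclicExt (FreeGroup (Fin n)) φ} (hx : x ∈ transLCS _ (α + ω)) :
    ∃ f, SemidirectProduct.inl f = x ∧ MagnusTrivialBelow (k + 1) f := by
  have hmem : ∀ m : ℕ, x ∈ leadSubgroup φ k m hk := fun m =>
    transLCS_le_leadSubgroup φ hk hα h m
      (transLCS_antitone (add_le_add le_rfl (Ordinal.natCast_lt_omega0 m).le) hx)
  obtain ⟨f, rfl, hf, t, ht⟩ := hmem 0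
  refine ⟨f, rfl, hf.succ ?_⟩
  rw [pow_zero, Module.End.one_apply] at ht
  -- The element f is fixed while m varies, so injectivity of T_k into the tensor algebra puts one
  -- and the same t in every Ω^m T_k.
  have ht0 : t = 0 := eq_zero_of_forall_mem_range_tensorPowDiff_pow hres fun m => by
    obtain ⟨g, hg, -, s, hs⟩ := hmem m
    rw [SemidirectProduct.inl_injective hg, ht] at hs
    exact ⟨s, toTensorAlgebra_injective k hs⟩
  rw [ht, ht0, map_zero]

theorem exists_inl_of_mem_transLCS_two (φ : MulAut (FreeGroup (Fin n)))
    {x : CyclicExt (FreeGroup (Fin n)) φ} (hx : x ∈ transLCS _ (2 : Ordinal.{0})) :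
    ∃ f, SemidirectProduct.inl f = x ∧ MagnusTrivialBelow 1 f := by
  rw [← one_add_one_eq_two, transLCS_add_one _ le_rfl, transLCS_one] at hx
  have h := Abelianization.commutator_subset_ker
    (SemidirectProduct.rightHom : CyclicExt (FreeGroup (Fin n)) φ →* Multiplicative ℤ) hx
  rw [← SemidirectProduct.range_inl_eq_ker_rightHom] at h
  obtain ⟨f, hf⟩ := h
  exact ⟨f, hf, magnusTrivialBelow_one f⟩

theorem exists_magnusTrivialBelow {φ : MulAut (FreeGroup (Fin n))}
    (h : ∀ k : ℕ, 1 ≤ k → ResiduallyNilpotent (CyclicExt (FreeAbTensor n k) (tensorAut φ k)))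
    (k : ℕ) {x : CyclicExt (FreeGroup (Fin n)) φ} (hx : x ∈ transLCS _ (ω * (k + 1))) :
    ∃ f, SemidirectProduct.inl f = x ∧ MagnusTrivialBelow (k + 2) f := by
  induction k generalizing x with
  | zero =>
    refine exists_magnusTrivialBelow_succ le_rfl (h 1 le_rfl) (α := 2) one_le_two
      (fun y hy => exists_inl_of_mem_transLCS_two φ hy) ?_
    -- The descent starts at γ_2 ≤ F = D_1, and 2 + ω = ω loses nothing; hence the pairing of ω(k+1)
    -- with degree k + 2.
    have h2 : (2 : Ordinal.{0}) + ω = ω := Ordinal.natCast_add_omega0 2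
    rw [h2]
    simpa using hx
  | succ k ih =>
    refine exists_magnusTrivialBelow_succ (by omega) (h (k + 2) (by omega)) (α := ω * (k + 1)) ?_
      (fun y hy => ih hy) ?_
    · rw [mul_add_one]
      exact Ordinal.one_lt_omega0.le.trans le_add_self
    · rwa [← mul_add_one, ← Nat.cast_succ]

end CyclicExtension

/-! ### Vanishing at ω² and minimality of ω² -/

theorem mainTheorem3 (n : ℕ) (φ : MulAut (FreeGroup (Fin n)))
    (h : ∀ k : ℕ, 1 ≤ k → ResiduallyNilpotent (CyclicExt (FreeAbTensor n k) (tensorAut φ k))) :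
    transLCS (CyclicExt (FreeGroup (Fin n)) φ) (ω ^ 2) = ⊥ ∧
      (¬ ResiduallyNilpotent (CyclicExt (FreeGroup (Fin n)) φ) →
        IsLCSLength (CyclicExt (FreeGroup (Fin n)) φ) (ω ^ 2)) := by
  have hω : ∀ k : ℕ, ω * ((k : Ordinal.{0}) + 1) ≤ ω ^ 2 := fun k => by
    rw [sq]
    exact mul_le_mul_right (by exact_mod_cast (Ordinal.natCast_lt_omega0 (k + 1)).le) _
  have hbot : transLCS (CyclicExt (FreeGroup (Fin n)) φ) (ω ^ 2) = ⊥ := by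
    refine (Subgroup.eq_bot_iff_forall _).mpr fun x hx => ?_
    obtain ⟨f, rfl, -⟩ := exists_magnusTrivialBelow h 0 (transLCS_antitone (hω 0) hx)
    have hf : f = 1 := FreeGroup.eq_one_of_forall_magnusTrivialBelow fun k j hj => by
      obtain ⟨g, hg, hgk⟩ := exists_magnusTrivialBelow h k (transLCS_antitone (hω k) hx)
      rw [SemidirectProduct.inl_injective hg] at hgk
      exact hgk j (by omega)
    rw [hf, map_one]
  refine ⟨hbot, fun hres => ⟨⟨?_, ?_⟩, fun β hβ => ?_⟩⟩
  · refine le_trans ?_ (hω 0)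
    rw [Nat.cast_zero, zero_add, mul_one]
    exact Ordinal.one_lt_omega0.le
  · exact le_antisymm (hbot ▸ bot_le) (transLCS_add_one_le _)
  · by_contra hlt
    rw [not_le] at hlt
    -- Stabilisation at β < ω² makes γ_β equal to γ_{ω²} = 1.
    have hβbot := (transLCS_eq_of_eq_add_one hβ.1 hβ.2 hlt.le).symm.trans hbot
    have hsolv := isSolvable_transLCS_omega0 hlt hβbot
    have hmem : ∀ x ∈ transLCS (CyclicExt (FreeGroup (Fin n)) φ) ω,
        ∃ f, SemidirectProduct.inl f = x ∧ MagnusTrivialBelow 2 f := fun x hx =>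
      exists_magnusTrivialBelow h 0 (by simpa using hx)
    -- γ_ω lies in the image of F_n; pulling it back gives the normal subgroup of a free group to
    -- which the solvability argument applies.
    let H := (transLCS (CyclicExt (FreeGroup (Fin n)) φ) ω).comap SemidirectProduct.inl
    have hH : Group.IsSolvable H := Group.isSolvable_of_isSolvable_injective
      (f := (SemidirectProduct.inl : _ →* CyclicExt (FreeGroup (Fin n)) φ).subgroupComap
        (transLCS (CyclicExt (FreeGroup (Fin n)) φ) ω))
      fun a b hab => Subtype.ext (SemidirectProduct.inl_injective (congrArg Subtype.val hab))
    have hHbot : H = ⊥ := FreeGroup.eq_bot_of_isSolvable_of_le_commutator H hH fun f hf => by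
      obtain ⟨g, hg, hg2⟩ := hmem _ hf
      rw [← SemidirectProduct.inl_injective hg]
      exact hg2.mem_commutator
    refine hres (residuallyNilpotent_of_transLCS_omega0 ?_)
    refine (Subgroup.eq_bot_iff_forall _).mpr fun x hx => ?_
    obtain ⟨f, rfl, -⟩ := hmem x hx
    have hf : f ∈ H := hx
    rw [hHbot, Subgroup.mem_bot] at hf
    rw [hf, map_one]
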